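/- Let $A$ be a commutative ring. Two $A$-linear maps $\varphi:E\to F$ and $\varphi^\bullet:F\to E$ are called \emph{crossed} if $\operatorname{Im}\varphi\oplus\operatorname{Ker}\varphi^\bullet=F$ and $\operatorname{Ker}\varphi\oplus\operatorname{Im}\varphi^\bullet=E$. In this case $\varphi$ restricts to an isomorphism $\varphi_0:\operatorname{Im}\varphi^\bullet\to\operatorname{Im}\varphi$, and the \emph{generalized inverse of $\varphi$ via $\varphi^\bullet$} is the map $\mathrm{Ig}(\varphi,\varphi^\bullet)=\varphi_0^{-1}\circ\pi:F\to E$, where $\pi:F\to\operatorname{Im}\varphi$ is the projection parallel to $\operatorname{Ker}\varphi^\bullet$. Finitely generated projective modules $E$ and $F$ are given by projection matrices $P_E\in A^{p\times p}$ and $P_F\in A^{q\times q}$ whose images they are, and $\varphi$, $\varphi^\bullet$ by the matrices $M$, $M^\bullet$ that represent them, with $P_FMP_E=M$ and $P_EM^\bullet P_F=M^\bullet$. The ring is equipped with a divisibility test: on the question ``$x\in\langle y\rangle$?'' it answers correctly and, in the positive case, gives some $z$ with $x=zy$. Cost is measured by the number of arithmetic operations ($+,-,\times$) in $A$ and the number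 of divisibility tests. \textbf{Theorem.} There are an algorithm, the same for all rings $A$ and all sizes, and an absolute constant $C$ such that, for all such data with $p,q\le n$, the algorithm decides whether $\varphi$ and $\varphi^\bullet$ are crossed, with at most $Cn^4$ arithmetic operations and at most $Cn^3$ tests ``$x\in\langle y\rangle$?''; and in the positive case it then computes (the matrices representing) both generalized inverses $\mathrm{Ig}(\varphi,\varphi^\bullet)$ and $\mathrm{Ig}(\varphi^\bullet,\varphi)$ with at most $Cn^4$ further arithmetic operations and no further test. -/

import Mathlib

/-! Crossed linear maps and the generalized inverse of one along the other -/

section Crossed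

variable {R E F : Type*} [CommRing R] [AddCommGroup E] [Module R E]
  [AddCommGroup F] [Module R F]

/-- `φ : E → F` and `φ' : F → E` are crossed if `Im φ ⊕ Ker φ' = F` and `Ker φ ⊕ Im φ' = E`. -/
def Crossed (φ : E →ₗ[R] F) (φ' : F →ₗ[R] E) : Prop :=
  IsCompl (LinearMap.range φ) (LinearMap.ker φ') ∧
    IsCompl (LinearMap.ker φ) (LinearMap.range φ')

theorem Crossed.symm {φ : E →ₗ[R] F} {φ' : F →ₗ[R] E} (h : Crossed φ φ') : Crossed φ' φ :=
  ⟨h.2.symm, h.1.symm⟩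

/-- The map `Im φ' → Im φ` induced by `φ`. -/
def crossedRestrict (φ : E →ₗ[R] F) (φ' : F →ₗ[R] E) :
    LinearMap.range φ' →ₗ[R] LinearMap.range φ :=
  φ.rangeRestrict ∘ₗ (LinearMap.range φ').subtype

theorem crossedRestrict_bijective {φ : E →ₗ[R] F} {φ' : F →ₗ[R] E} (h : Crossed φ φ') :
    Function.Bijective (crossedRestrict φ φ') := by
  constructor
  · rw [← LinearMap.ker_eq_bot, LinearMap.ker_eq_bot']
    rintro ⟨x, hx⟩ hz
    have hk : x ∈ LinearMap.ker φ := congrArg Subtype.val hz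
    have := Submodule.disjoint_def.mp h.2.disjoint x hk hx
    exact Subtype.ext this
  · rintro ⟨_, x, rfl⟩
    have hx : x ∈ LinearMap.ker φ ⊔ LinearMap.range φ' := by
      rw [h.2.sup_eq_top]; trivial
    obtain ⟨k, hk, w, hw, rfl⟩ := Submodule.mem_sup.mp hx
    refine ⟨⟨w, hw⟩, Subtype.ext ?_⟩
    have hk' : φ k = 0 := hk
    simp [crossedRestrict, hk']

/-- The generalized inverse `Ig(φ, φ')` of `φ` via a map `φ'` crossed with `φ`: project `F` onto
`Im φ` along `Ker φ'`, then apply the inverse of the isomorphism `Im φ' → Im φ` induced by `φ`. -/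
noncomputable def Ig (φ : E →ₗ[R] F) (φ' : F →ₗ[R] E) (h : Crossed φ φ') : F →ₗ[R] E :=
  (LinearMap.range φ').subtype ∘ₗ
    (LinearEquiv.ofBijective (crossedRestrict φ φ')
      (crossedRestrict_bijective h)).symm.toLinearMap ∘ₗ
    Submodule.projectionOnto (LinearMap.range φ) (LinearMap.ker φ') h.1

end Crossed

/-! Projective modules given by projection matrices, and the matrices of their linear maps -/

/-- A projection matrix `P` of size `p` together with an identification of `E` with the image
of `P`.  A module has such data exactly when it is projective and generated by `p` elements. -/
structure ProjData (R : Type*) [CommRing R] (E : Type*) [AddCommGroup E] [Module R E]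
    (p : ℕ) where
  mat : Matrix (Fin p) (Fin p) R
  idem : mat * mat = mat
  equiv : E ≃ₗ[R] LinearMap.range mat.mulVecLin

section ProjData

variable {R E F : Type*} [CommRing R] [AddCommGroup E] [Module R E]
  [AddCommGroup F] [Module R F] {p q : ℕ}

/-- The inclusion `E → R ^ p`. -/
def ProjData.incl (D : ProjData R E p) : E →ₗ[R] (Fin p → R) :=
  (LinearMap.range D.mat.mulVecLin).subtype ∘ₗ D.equiv.toLinearMap

/-- The projection `R ^ p → E`, induced by `x ↦ P x`. -/
def ProjData.proj (D : ProjData R E p) : (Fin p → R) →ₗ[R] E :=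
  D.equiv.symm.toLinearMap ∘ₗ D.mat.mulVecLin.rangeRestrict

/-- The matrix that represents `φ : E → F`, that is, the matrix of `R ^ p → E → F → R ^ q`.
It is the only matrix `A` with `P_F A P_E = A` that induces `φ` on the images. -/
noncomputable def repMatrix (DE : ProjData R E p) (DF : ProjData R F q) (φ : E →ₗ[R] F) :
    Matrix (Fin q) (Fin p) R :=
  LinearMap.toMatrix' (DF.incl ∘ₗ φ ∘ₗ DE.proj)

end ProjData

/-! The machine model: programs over an arbitrary commutative ring.

The memory of a machine consists of registers `k = 0, 1, 2, …` that hold natural numbers (indices)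
and of two-dimensional arrays `a = 0, 1, 2, …` of ring elements.  A program is a finite text that
mentions neither the ring nor the size of the input.  The only operations on ring elements are the
constants `0` and `1`, copies, the arithmetic operations `+`, `-`, `*`, and the test `x ∈ ⟨y⟩ ?`;
only this test lets the control flow depend on ring elements.  All loops are bounded, so every
program stops.  Arithmetic operations and tests are counted. -/

namespace RingProg

/-- Index expressions; `sub` is truncated. -/
inductive IExp : Type
  | const (c : ℕ)
  | reg (k : ℕ)
  | add (e f : IExp)
  | sub (e f : IExp)
  | mul (e f : IExp)

def IExp.eval (idx : ℕ → ℕ) : IExp → ℕ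
  | .const c => c
  | .reg k => idx k
  | .add e f => e.eval idx + f.eval idx
  | .sub e f => e.eval idx - f.eval idx
  | .mul e f => e.eval idx * f.eval idx

/-- A memory cell for a ring element: the entry `(row, col)` of the array `arr`. -/
structure Ref : Type where
  arr : ℕ
  row : IExp
  col : IExp

/-- Programs.
* `setIdx k e`: index register `k` receives the value of `e`;
* `zero d`, `one d`, `copy d x`: the cell `d` receives `0`, `1`, or the content of `x`;
* `add d x y`, `sub d x y`, `mul d x y`: `d` receives the result of the arithmetic operation;
* `test x y d c₁ c₂`: if `x ∈ ⟨y⟩`, then `d` receives an element `z` with `x = z * y` and `c₁` is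
  run, otherwise `c₂` is run;
* `ifLe e f c₁ c₂`: run `c₁` if `e ≤ f` and `c₂` otherwise;
* `loop k e c`: run `c` once for each value `0, 1, …, N - 1` of index register `k`, where `N` is
  the value of `e` on entry. -/
inductive Prog : Type
  | skip
  | seq (c₁ c₂ : Prog)
  | setIdx (k : ℕ) (e : IExp)
  | zero (d : Ref)
  | one (d : Ref)
  | copy (d x : Ref)
  | add (d x y : Ref)
  | sub (d x y : Ref)
  | mul (d x y : Ref)
  | test (x y d : Ref) (c₁ c₂ : Prog)
  | ifLe (e f : IExp) (c₁ c₂ : Prog)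
  | loop (k : ℕ) (e : IExp) (c : Prog)

/-- Machine states, with the numbers of arithmetic operations and of tests made so far. -/
structure State (R : Type*) where
  idx : ℕ → ℕ
  mem : ℕ → ℕ → ℕ → R
  ops : ℕ
  tests : ℕ

section Semantics

variable {R : Type*} [CommRing R]

def State.get (s : State R) (x : Ref) : R :=
  s.mem x.arr (x.row.eval s.idx) (x.col.eval s.idx)

def State.put (s : State R) (d : Ref) (v : R) : State R :=
  { s with
    mem := fun a i j =>
      if a = d.arr ∧ i = d.row.eval s.idx ∧ j = d.col.eval s.idx then v else s.mem a i j }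

def State.putIdx (s : State R) (k v : ℕ) : State R :=
  { s with idx := fun l => if l = k then v else s.idx l }

def State.countOp (s : State R) : State R := { s with ops := s.ops + 1 }

def State.countTest (s : State R) : State R := { s with tests := s.tests + 1 }

/-- `δ` is a divisibility test in `R`: on the question `x ∈ ⟨y⟩ ?` it answers `some z` with
`x = z * y` if `x ∈ ⟨y⟩`, and `none` otherwise. -/
def IsDivTest (δ : R → R → Option R) : Prop :=
  ∀ x y : R, (x ∈ Ideal.span {y} → ∃ z, δ x y = some z ∧ x = z * y) ∧
    (x ∉ Ideal.span {y} → δ x y = none)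

/-- Execution of a program over `R` with the divisibility test `δ`. -/
def run (δ : R → R → Option R) : Prog → State R → State R
  | .skip, s => s
  | .seq c₁ c₂, s => run δ c₂ (run δ c₁ s)
  | .setIdx k e, s => s.putIdx k (e.eval s.idx)
  | .zero d, s => s.put d 0
  | .one d, s => s.put d 1
  | .copy d x, s => s.put d (s.get x)
  | .add d x y, s => (s.put d (s.get x + s.get y)).countOp
  | .sub d x y, s => (s.put d (s.get x - s.get y)).countOp
  | .mul d x y, s => (s.put d (s.get x * s.get y)).countOp
  | .test x y d c₁ c₂, s =>
      match δ (s.get x) (s.get y) with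
      | some z => run δ c₁ (s.put d z).countTest
      | none => run δ c₂ s.countTest
  | .ifLe e f c₁ c₂, s =>
      if e.eval s.idx ≤ f.eval s.idx then run δ c₁ s else run δ c₂ s
  | .loop k e c, s =>
      (List.range (e.eval s.idx)).foldl (fun t i => run δ c (t.putIdx k i)) s

/-- The array that contains the matrix `A`, padded with zeros. -/
def ofMatrix {p q : ℕ} (A : Matrix (Fin q) (Fin p) R) (i j : ℕ) : R :=
  if h : i < q ∧ j < p then A ⟨i, h.1⟩ ⟨j, h.2⟩ else 0

/-- The initial state: index registers `0` and `1` contain the sizes `p` and `q`, arrays `0` to `3`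
the matrices `P_E`, `P_F`, `A`, `A'`; everything else is `0`. -/
def input {p q : ℕ} (PE : Matrix (Fin p) (Fin p) R) (PF : Matrix (Fin q) (Fin q) R)
    (A : Matrix (Fin q) (Fin p) R) (A' : Matrix (Fin p) (Fin q) R) : State R where
  idx
    | 0 => p
    | 1 => q
    | _ => 0
  mem
    | 0 => ofMatrix PE
    | 1 => ofMatrix PF
    | 2 => ofMatrix A
    | 3 => ofMatrix A'
    | _ => fun _ _ => 0
  ops := 0
  tests := 0

/-- The array `a` of the state `s` contains the matrix `B`. -/
def State.Holds {p q : ℕ} (s : State R) (a : ℕ) (B : Matrix (Fin q) (Fin p) R) : Prop :=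
  ∀ (i : Fin q) (j : Fin p), s.mem a i j = B i j

end Semantics

end RingProg

/-! Put `T = M * M'`, the matrix of `φ ∘ φ'`. If the maps are crossed, `T` is invertible on `Im φ`
and zero on `Ker φ'`, hence has a group inverse `S`; moreover `T S M = M`, `M' S T = M'`, and the
generalized inverses are `M' S` and `S M` (`Crossed.exists_groupInverse`). Conversely, any matrix
`Z` commuting with `T` that satisfies `T Z M = M` and `M' T Z = M'` forces the maps to be crossed
(`crossed_of_matrix`). So it suffices to compute a `Z` that is correct whenever `S` exists and to
verify these two equations; if `S` does not exist, whatever was computed is harmless.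

To find `Z`, let `P = T S`. The coefficients `e j` of `det (1 - P + X P)` are orthogonal idempotents
with sum `1`, and `e j` cuts out the locus of rank `j`. There `det (1 - X T) = ∑ a k X ^ k` has
degree `j` and `a j` is invertible (`IsGroupInverse.coeff_mul_charpolyRev_coeff`). Going down from
`k = q`, with `d` the idempotent that remains, `b = d * a k` therefore lies in `⟨b ^ 2⟩`, and one
test yields the idempotent that generates `⟨b⟩` and an inverse of `a k` on that component.
Cayley–Hamilton, after cancelling powers of `T`, gives there `T = T ^ 2 Z` with `Z` a polynomial in
`T`. The sum over all components satisfies `T ^ 2 Z = T` (`IsGroupInverse.mul_mul_sum_horner`),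
which is enough to replace `S` by `Z` in all formulas (`IsGroupInverse.formulas`).

The `a k` are computed without division: if `T_r` keeps the first `r` rows of `T`, then `det (1 - X
T_r) / det (1 - X T_(r+1))` is a diagonal entry of `∑ X ^ k T_(r+1) ^ k`
(`charpolyRev_rowTrunc_succ`), so each row costs one Krylov sequence and one division of truncated
series. This and Horner's rule for `Z` cost `O(n ^ 4)`. There are `q` tests for idempotents, and
`2pq` tests modulo `0` serve as equality tests. -/

namespace RingProg

/-! ### Frames and costs of programs -/

/-- The arrays that a program may write to. -/
def Prog.arrays : Prog → List ℕ
  | .skip => []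
  | .seq c₁ c₂ => c₁.arrays ++ c₂.arrays
  | .setIdx _ _ => []
  | .zero d => [d.arr]
  | .one d => [d.arr]
  | .copy d _ => [d.arr]
  | .add d _ _ => [d.arr]
  | .sub d _ _ => [d.arr]
  | .mul d _ _ => [d.arr]
  | .test _ _ d c₁ c₂ => d.arr :: (c₁.arrays ++ c₂.arrays)
  | .ifLe _ _ c₁ c₂ => c₁.arrays ++ c₂.arrays
  | .loop _ _ c => c.arrays

/-- The index registers that a program may write to. -/
def Prog.regs : Prog → List ℕ
  | .seq c₁ c₂ => c₁.regs ++ c₂.regs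
  | .setIdx k _ => [k]
  | .test _ _ _ c₁ c₂ => c₁.regs ++ c₂.regs
  | .ifLe _ _ c₁ c₂ => c₁.regs ++ c₂.regs
  | .loop k _ c => k :: c.regs
  | _ => []

/-- The only assignments to index registers are to the register `2`, and the bounds of all loops
are registers other than `2`. -/
def Prog.Tame : Prog → Prop
  | .seq c₁ c₂ => c₁.Tame ∧ c₂.Tame
  | .setIdx k _ => k = 2
  | .test _ _ _ c₁ c₂ => c₁.Tame ∧ c₂.Tame
  | .ifLe _ _ c₁ c₂ => c₁.Tame ∧ c₂.Tame
  | .loop _ (.reg r) c => r ≠ 2 ∧ c.Tame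
  | .loop _ _ _ => False
  | _ => True

/-- A bound for the number of arithmetic operations, if loops run at most `n` times. -/
def Prog.opsBound (n : ℕ) : Prog → ℕ
  | .seq c₁ c₂ => c₁.opsBound n + c₂.opsBound n
  | .add _ _ _ => 1
  | .sub _ _ _ => 1
  | .mul _ _ _ => 1
  | .test _ _ _ c₁ c₂ => c₁.opsBound n + c₂.opsBound n
  | .ifLe _ _ c₁ c₂ => c₁.opsBound n + c₂.opsBound n
  | .loop _ _ c => n * c.opsBound n
  | _ => 0

/-- A bound for the number of tests, if loops run at most `n` times. -/
def Prog.testsBound (n : ℕ) : Prog → ℕ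
  | .seq c₁ c₂ => c₁.testsBound n + c₂.testsBound n
  | .test _ _ _ c₁ c₂ => 1 + (c₁.testsBound n + c₂.testsBound n)
  | .ifLe _ _ c₁ c₂ => c₁.testsBound n + c₂.testsBound n
  | .loop _ _ c => n * c.testsBound n
  | _ => 0

theorem State.put_mem_of_ne {R : Type*} (s : State R) (d : Ref) (v : R) {a : ℕ} (h : a ≠ d.arr) :
    (s.put d v).mem a = s.mem a := by
  funext i j
  simp [State.put, h]

section

variable {R : Type*} [CommRing R] {δ : R → R → Option R}

theorem foldl_range_invariant {α : Type*} (f : α → ℕ → α) (I : ℕ → α → Prop) (N : ℕ) (s : α)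
    (h0 : I 0 s) (hs : ∀ i < N, ∀ t, I i t → I (i + 1) (f t i)) :
    I N ((List.range N).foldl f s) := by
  induction N with
  | zero => simpa using h0
  | succ N ih =>
    rw [List.range_succ, List.foldl_append]
    exact hs N (Nat.lt_succ_self N) _ (ih fun i hi => hs i (by omega))

/-- The frame rule: `Prog.arrays` is computed from the text alone, so `simp` can check that one
stage leaves the data of another untouched. -/
theorem run_mem_of_notMem (c : Prog) (s : State R) {a : ℕ} (ha : a ∉ c.arrays) :
    (run δ c s).mem a = s.mem a := by
  induction c generalizing s with
  | skip => rfl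
  | seq c₁ c₂ h₁ h₂ =>
    simp only [Prog.arrays, List.mem_append, not_or] at ha
    simp only [run]
    rw [h₂ _ ha.2, h₁ _ ha.1]
  | setIdx k e => rfl
  | zero d => exact State.put_mem_of_ne _ _ _ (by simpa [Prog.arrays] using ha)
  | one d => exact State.put_mem_of_ne _ _ _ (by simpa [Prog.arrays] using ha)
  | copy d x => exact State.put_mem_of_ne _ _ _ (by simpa [Prog.arrays] using ha)
  | add d x y => exact State.put_mem_of_ne s _ _ (by simpa [Prog.arrays] using ha)
  | sub d x y => exact State.put_mem_of_ne s _ _ (by simpa [Prog.arrays] using ha)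
  | mul d x y => exact State.put_mem_of_ne s _ _ (by simpa [Prog.arrays] using ha)
  | test x y d c₁ c₂ h₁ h₂ =>
    simp only [Prog.arrays, List.mem_cons, List.mem_append, not_or] at ha
    simp only [run]
    split
    · rw [h₁ _ ha.2.1]
      exact State.put_mem_of_ne s _ _ ha.1
    · rw [h₂ _ ha.2.2]
      rfl
  | ifLe e f c₁ c₂ h₁ h₂ =>
    simp only [Prog.arrays, List.mem_append, not_or] at ha
    simp only [run]
    split
    · exact h₁ _ ha.1
    · exact h₂ _ ha.2
  | loop k e c h =>
    refine foldl_range_invariant _ (fun _ t => t.mem a = s.mem a) _ s rfl ?_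
    intro i _ t ht
    rw [h _ ha]
    exact ht

theorem run_idx_of_notMem (c : Prog) (s : State R) {r : ℕ} (hr : r ∉ c.regs) :
    (run δ c s).idx r = s.idx r := by
  induction c generalizing s with
  | skip | zero | one | copy | add | sub | mul => rfl
  | seq c₁ c₂ h₁ h₂ =>
    simp only [Prog.regs, List.mem_append, not_or] at hr
    simp only [run]
    rw [h₂ _ hr.2, h₁ _ hr.1]
  | setIdx k e =>
    have : r ≠ k := by simpa [Prog.regs] using hr
    simp [run, State.putIdx, this]
  | test x y d c₁ c₂ h₁ h₂ =>
    simp only [Prog.regs, List.mem_append, not_or] at hr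
    simp only [run]
    split
    · rw [h₁ _ hr.1]; rfl
    · rw [h₂ _ hr.2]; rfl
  | ifLe e f c₁ c₂ h₁ h₂ =>
    simp only [Prog.regs, List.mem_append, not_or] at hr
    simp only [run]
    split
    · exact h₁ _ hr.1
    · exact h₂ _ hr.2
  | loop k e c h =>
    simp only [Prog.regs, List.mem_cons, not_or] at hr
    refine foldl_range_invariant _ (fun _ t => t.idx r = s.idx r) _ s rfl ?_
    intro i _ t ht
    rw [h _ hr.2, ← ht]
    simp [State.putIdx, hr.1]

/-- Apart from register `2`, registers only ever hold sizes or loop counters, and a counter stays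
below its bound; so any of them may bound a further loop. Register `2` is excluded because the
answer `1` exceeds `n` when `n = 0`. -/
theorem Prog.Tame.run_cost {c : Prog} (hc : c.Tame) {n : ℕ} (s : State R)
    (hs : ∀ k ≠ 2, s.idx k ≤ n) :
    (∀ k ≠ 2, (run δ c s).idx k ≤ n) ∧ (run δ c s).ops ≤ s.ops + c.opsBound n ∧
      (run δ c s).tests ≤ s.tests + c.testsBound n := by
  induction c generalizing s with
  | skip | zero | one | copy | add | sub | mul => exact ⟨hs, by rfl, by rfl⟩
  | seq c₁ c₂ h₁ h₂ =>
    obtain ⟨a₁, b₁, d₁⟩ := h₁ hc.1 s hs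
    obtain ⟨a₂, b₂, d₂⟩ := h₂ hc.2 _ a₁
    refine ⟨a₂, ?_, ?_⟩ <;> simp only [run, opsBound, testsBound] <;> omega
  | setIdx k e =>
    refine ⟨fun l hl => ?_, by rfl, by rfl⟩
    have : l ≠ k := fun h => hl (h.trans hc)
    simpa [run, State.putIdx, this] using hs l hl
  | test x y d c₁ c₂ h₁ h₂ =>
    simp only [run]
    split
    · obtain ⟨a₁, b₁, d₁⟩ := h₁ hc.1 (s.put d _).countTest hs
      refine ⟨a₁, b₁.trans ?_, d₁.trans ?_⟩ <;>
        simp only [State.countTest, State.put, opsBound, testsBound] <;> omega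
    · obtain ⟨a₁, b₁, d₁⟩ := h₂ hc.2 s.countTest hs
      refine ⟨a₁, b₁.trans ?_, d₁.trans ?_⟩ <;>
        simp only [State.countTest, opsBound, testsBound] <;> omega
  | ifLe e f c₁ c₂ h₁ h₂ =>
    simp only [run]
    split
    · obtain ⟨a₁, b₁, d₁⟩ := h₁ hc.1 s hs
      refine ⟨a₁, ?_, ?_⟩ <;> simp only [opsBound, testsBound] <;> omega
    · obtain ⟨a₁, b₁, d₁⟩ := h₂ hc.2 s hs
      refine ⟨a₁, ?_, ?_⟩ <;> simp only [opsBound, testsBound] <;> omega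
  | loop k e c h =>
    cases e with
    | reg r =>
      have hN : (IExp.reg r).eval s.idx ≤ n := hs r hc.1
      have key := foldl_range_invariant (fun t i => run δ c (t.putIdx k i))
        (fun i t => (∀ k ≠ 2, t.idx k ≤ n) ∧ t.ops ≤ s.ops + i * c.opsBound n ∧
          t.tests ≤ s.tests + i * c.testsBound n) ((IExp.reg r).eval s.idx) s
        ⟨hs, by simp, by simp⟩ (by
          rintro i hi t ⟨a, b, d⟩
          obtain ⟨a₁, b₁, d₁⟩ := h hc.2 (t.putIdx k i) (by
            intro l hl
            by_cases hlk : l = k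
            · simp only [State.putIdx, hlk, if_true]; omega
            · simpa [State.putIdx, hlk] using a l hl)
          refine ⟨a₁, b₁.trans ?_, d₁.trans ?_⟩ <;>
            simp only [State.putIdx, Nat.add_mul, Nat.one_mul] <;> omega)
      refine ⟨key.1, key.2.1.trans ?_, key.2.2.trans ?_⟩ <;> simp only [opsBound, testsBound] <;>
        gcongr
    | _ => exact hc.elim

/-- Together with the upper bound `0` for the inversion program this gives equality of the test
counts. -/
theorem tests_le_run_tests (c : Prog) (s : State R) : s.tests ≤ (run δ c s).tests := by
  induction c generalizing s with
  | skip | setIdx | zero | one | copy | add | sub | mul => exact le_rfl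
  | seq c₁ c₂ h₁ h₂ => exact (h₁ s).trans (h₂ _)
  | test x y d c₁ c₂ h₁ h₂ =>
    simp only [run]
    split
    · exact (Nat.le_succ _).trans (h₁ (s.put d _).countTest)
    · exact (Nat.le_succ _).trans (h₂ s.countTest)
  | ifLe e f c₁ c₂ h₁ h₂ =>
    simp only [run]
    split
    · exact h₁ s
    · exact h₂ s
  | loop k e c h =>
    exact foldl_range_invariant _ (fun _ t => s.tests ≤ t.tests) _ s le_rfl
      fun i _ t ht => ht.trans (h (t.putIdx k i))

/-! ### Rules for loops -/

/-- The states `s` and `t` agree except on what `c` and the register `k` change. -/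
structure Agree (c : Prog) (k : ℕ) (s t : State R) : Prop where
  mem : ∀ a, a ∉ c.arrays → t.mem a = s.mem a
  idx : ∀ r, r ∉ k :: c.regs → t.idx r = s.idx r

/-- `Agree` is carried along with the invariant, so every use of the rule gets the frame for free.
-/
theorem run_loop_state (I : ℕ → State R → Prop) (k : ℕ) (e : IExp) (c : Prog) (s : State R)
    (h0 : I 0 s)
    (hs : ∀ i < e.eval s.idx, ∀ t, Agree c k s t → I i t → I (i + 1) (run δ c (t.putIdx k i))) :
    I (e.eval s.idx) (run δ (.loop k e c) s) := by
  refine (foldl_range_invariant (fun t i => run δ c (t.putIdx k i))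
    (fun i t => Agree c k s t ∧ I i t) _ s
    ⟨⟨fun _ _ => rfl, fun _ _ => rfl⟩, h0⟩ ?_).2
  rintro i hi t ⟨ha, ht⟩
  refine ⟨⟨fun a hm => ?_, fun r hr => ?_⟩, hs i hi t ha ht⟩
  · rw [run_mem_of_notMem _ _ hm, ← ha.mem a hm]
    rfl
  · rw [run_idx_of_notMem _ _ (fun h => hr (List.mem_cons_of_mem _ h)), ← ha.idx r hr]
    have : r ≠ k := fun h => hr (h ▸ List.mem_cons_self)
    simp [State.putIdx, this]

theorem run_loop_mem (I : ℕ → (ℕ → ℕ → ℕ → R) → Prop) (k : ℕ) (e : IExp) (c : Prog)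
    (s : State R) (h0 : I 0 s.mem)
    (hs : ∀ i < e.eval s.idx, ∀ t, Agree c k s t → t.idx k = i → I i t.mem →
      I (i + 1) (run δ c t).mem) :
    I (e.eval s.idx) (run δ (.loop k e c) s).mem := by
  refine run_loop_state (fun i t => I i t.mem) k e c s h0 fun i hi t ht hI => ?_
  refine hs i hi (t.putIdx k i) ⟨ht.mem, fun r hr => ?_⟩ (by simp [State.putIdx]) hI
  have : r ≠ k := fun h => hr (h ▸ List.mem_cons_self)
  rw [← ht.idx r hr]
  simp [State.putIdx, this]

/-- A loop whose `i`-th round rewrites the cells `(a, b)` of the array `d` with `key a b = i`. -/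
theorem run_loop_update (d : ℕ) (ok : ℕ → ℕ → Prop) (key : ℕ → ℕ → ℕ) (val : ℕ → ℕ → R → R)
    (k : ℕ) (e : IExp) (c : Prog) (s : State R)
    (hs : ∀ t, Agree c k s t → (∀ a b, ¬ ok a b → t.mem d a b = s.mem d a b) →
      t.idx k < e.eval s.idx → ∀ a b,
      (ok a b → key a b = t.idx k → (run δ c t).mem d a b = val a b (t.mem d a b)) ∧
      (¬ (ok a b ∧ key a b = t.idx k) → (run δ c t).mem d a b = t.mem d a b)) (a b : ℕ) :
    (ok a b → key a b < e.eval s.idx →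
      (run δ (.loop k e c) s).mem d a b = val a b (s.mem d a b)) ∧
    (¬ (ok a b ∧ key a b < e.eval s.idx) →
      (run δ (.loop k e c) s).mem d a b = s.mem d a b) := by
  refine run_loop_mem (fun i m => ∀ a b, (ok a b → key a b < i → m d a b = val a b (s.mem d a b)) ∧
    (¬ (ok a b ∧ key a b < i) → m d a b = s.mem d a b)) k e c s
    (fun a b => ⟨by simp, by simp⟩) ?_ a b
  rintro i hi t ht rfl hI a b
  obtain ⟨h₁, h₂⟩ := hI a b
  obtain ⟨g₁, g₂⟩ := hs t ht (fun a b h => (hI a b).2 fun h' => h h'.1) hi a b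
  constructor
  · intro h h'
    rcases Nat.lt_succ_iff_lt_or_eq.mp h' with h' | h'
    · rw [g₂ (by omega), h₁ h h']
    · rw [g₁ h h', h₂ (by omega)]
  · intro h
    rw [g₂ (by rintro ⟨h3, h4⟩; exact h ⟨h3, by omega⟩),
      h₂ (by rintro ⟨h3, h4⟩; exact h ⟨h3, by omega⟩)]

/-- A loop that adds `f i` to the cell `(a, b)` of the array `d` in its `i`-th round. -/
theorem run_loop_sum (d a b : ℕ) (f : ℕ → R) (k : ℕ) (e : IExp) (c : Prog) (s : State R)
    (hs : ∀ t, Agree c k s t → (∀ a' b', ¬ (a' = a ∧ b' = b) → t.mem d a' b' = s.mem d a' b') →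
      t.idx k < e.eval s.idx → ∀ a' b', (run δ c t).mem d a' b' =
        if a' = a ∧ b' = b then t.mem d a b + f (t.idx k) else t.mem d a' b') (a' b' : ℕ) :
    (run δ (.loop k e c) s).mem d a' b' =
      if a' = a ∧ b' = b then s.mem d a b + ∑ i ∈ Finset.range (e.eval s.idx), f i
      else s.mem d a' b' := by
  refine run_loop_mem (fun n m => ∀ a' b', m d a' b' = if a' = a ∧ b' = b then
    s.mem d a b + ∑ i ∈ Finset.range n, f i else s.mem d a' b') k e c s ?_ ?_ a' b'
  · intro a' b'
    split_ifs with h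
    · simp [h.1, h.2]
    · rfl
  · rintro i hi t ht rfl hI a' b'
    rw [hs t ht (fun a' b' h => by rw [hI, if_neg h]) hi, hI a b, hI a' b']
    split_ifs with h h'
    · rw [Finset.sum_range_succ, add_assoc]
    · exact absurd ⟨rfl, rfl⟩ h'
    · rfl

end

end RingProg

/-! ### The characteristic polynomial by power series -/

section Charpoly

open Polynomial Matrix

variable {R : Type*} [CommRing R] {q : ℕ}

/-- The matrix `T` with all rows from the `r`-th on replaced by zero. -/
def rowTrunc (T : Matrix (Fin q) (Fin q) R) (r : ℕ) : Matrix (Fin q) (Fin q) R :=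
  Matrix.of fun i j => if (i : ℕ) < r then T i j else 0

theorem rowTrunc_zero (T : Matrix (Fin q) (Fin q) R) : rowTrunc T 0 = 0 := by
  ext i j; simp [rowTrunc]

theorem rowTrunc_self (T : Matrix (Fin q) (Fin q) R) : rowTrunc T q = T := by
  ext i j; simp [rowTrunc]

theorem powerSeries_geometric_mul (T : Matrix (Fin q) (Fin q) R) :
    (Matrix.of fun i j => PowerSeries.mk fun k => (T ^ k) i j) *
      (1 - (PowerSeries.X : PowerSeries R) • T.map PowerSeries.C) = 1 := by
  rw [mul_sub, mul_one, sub_eq_iff_eq_add, Matrix.mul_smul]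
  ext i j n
  rw [Matrix.add_apply, Matrix.smul_apply, smul_eq_mul, map_add]
  cases n with
  | zero =>
    by_cases h : i = j <;> simp [Matrix.one_apply, h]
  | succ n =>
    rw [PowerSeries.coeff_succ_X_mul, Matrix.mul_apply, map_sum]
    by_cases h : i = j <;>
      simp [Matrix.one_apply, h, pow_succ, Matrix.mul_apply, PowerSeries.coeff_one]

/-- Cramer's rule for the `(r, r)` entry of the inverse of `1 - X B`, which is the geometric series
of `B`. The cofactor replaces row `r` by a unit vector, and this is what zeroing row `r` of `B` does
to `1 - X B`. -/
theorem charpolyRev_rowTrunc_succ (T : Matrix (Fin q) (Fin q) R) (r : Fin q) :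
    (PowerSeries.mk fun k => (rowTrunc T (r + 1) ^ k) r r) *
      ((rowTrunc T (r + 1)).charpolyRev : PowerSeries R) = (rowTrunc T r).charpolyRev := by
  set B := rowTrunc T (r + 1) with hB
  set M : Matrix (Fin q) (Fin q) R[X] := 1 - (X : R[X]) • B.map C with hM
  have hadj : M.adjugate r r = (rowTrunc T r).charpolyRev := by
    rw [Matrix.adjugate_apply, Matrix.charpolyRev]
    congr 1
    ext1 i j
    by_cases hi : i = r
    · subst hi
      simp [rowTrunc, Matrix.one_apply, Pi.single_apply, eq_comm]
    · have hi' : (i : ℕ) ≠ r := fun h => hi (Fin.ext h)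
      have : i ≤ r ↔ i < r := ⟨fun h => lt_of_le_of_ne h hi, le_of_lt⟩
      simp [hi, hM, hB, rowTrunc, this]
  let f : R[X] →+* PowerSeries R := Polynomial.coeToPowerSeries.ringHom
  have hf : f.mapMatrix M = 1 - (PowerSeries.X : PowerSeries R) • B.map PowerSeries.C := by
    ext1 i j
    by_cases h : i = j <;> simp [hM, f, h, mul_comm (PowerSeries.X)]
  have key := powerSeries_geometric_mul B
  rw [← hf] at key
  set G : Matrix (Fin q) (Fin q) (PowerSeries R) :=
    Matrix.of fun i j => PowerSeries.mk fun k => (B ^ k) i j with hG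
  -- The left inverse `G` turns `M * adj M = det M` into a formula for the adjugate.
  have h2 : (f.mapMatrix M).adjugate = (f.mapMatrix M).det • G := by
    calc (f.mapMatrix M).adjugate = (G * f.mapMatrix M) * (f.mapMatrix M).adjugate := by
          rw [key, one_mul]
      _ = (f.mapMatrix M).det • G := by
          rw [mul_assoc, Matrix.mul_adjugate, Matrix.mul_smul, mul_one]
  have h3 := congrFun (congrFun h2 r) r
  rw [← RingHom.map_adjugate, ← RingHom.map_det] at h3
  simp only [RingHom.mapMatrix_apply, Matrix.map_apply, hadj, Matrix.smul_apply, hG,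
    Matrix.of_apply, smul_eq_mul] at h3
  rw [mul_comm]
  exact h3.symm

theorem coeff_charpolyRev_rowTrunc_succ (T : Matrix (Fin q) (Fin q) R) (r : Fin q) (k : ℕ) :
    (rowTrunc T (r + 1)).charpolyRev.coeff (k + 1) =
      (rowTrunc T r).charpolyRev.coeff (k + 1) -
        ∑ j ∈ Finset.range (k + 1), (rowTrunc T (r + 1) ^ (j + 1)) r r *
          (rowTrunc T (r + 1)).charpolyRev.coeff (k - j) := by
  have h := congrArg (PowerSeries.coeff (k + 1)) (charpolyRev_rowTrunc_succ T r)
  rw [PowerSeries.coeff_mul, Finset.Nat.sum_antidiagonal_eq_sum_range_succ_mk,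
    Finset.sum_range_succ'] at h
  simp only [PowerSeries.coeff_mk, Polynomial.coeff_coe, pow_zero, Matrix.one_apply_eq,
    one_mul, Nat.sub_zero, Nat.add_sub_add_right] at h
  rw [← h]
  ring

theorem charpolyRev_coeff_zero (T : Matrix (Fin q) (Fin q) R) : T.charpolyRev.coeff 0 = 1 := by
  rw [Polynomial.coeff_zero_eq_eval_zero, Matrix.eval_charpolyRev]

/-- Division-free computation of the characteristic polynomial, row by row. -/
theorem coeff_charpolyRev_rowTrunc_succ_of_recursion (T : Matrix (Fin q) (Fin q) R) (r : Fin q)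
    (V : ℕ → ℕ → R) (f f' : ℕ → R)
    (hV0 : ∀ i < q, V 0 i = if i = r then 1 else 0)
    (hV : ∀ k < q, ∀ i : Fin q, V (k + 1) i = ∑ j : Fin q, rowTrunc T (r + 1) i j * V k j)
    (hf : ∀ k ≤ q, f k = (rowTrunc T r).charpolyRev.coeff k)
    (hf0 : f' 0 = 1)
    (hf' : ∀ k < q, f' (k + 1) =
      f (k + 1) - V (k + 1) r - ∑ j ∈ Finset.range k, V (j + 1) r * f' (k - j)) :
    ∀ k ≤ q, f' k = (rowTrunc T (r + 1)).charpolyRev.coeff k := by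
  -- `V` is the Krylov sequence of the `r`-th unit vector, that is, column `r` of the powers.
  have hVp : ∀ k ≤ q, ∀ i : Fin q, V k i = (rowTrunc T (r + 1) ^ k) i r := by
    intro k
    induction k with
    | zero =>
      intro _ i
      rw [hV0 i i.2]
      simp [Matrix.one_apply, Fin.ext_iff]
    | succ k ih =>
      intro hk i
      rw [hV k hk, pow_succ', Matrix.mul_apply]
      exact Finset.sum_congr rfl fun j _ => by rw [ih (by omega)]
  intro k
  induction k using Nat.strong_induction_on with
  | _ k ihk =>
    intro hk
    cases k with
    | zero => rw [hf0, charpolyRev_coeff_zero]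
    | succ k =>
      have e := coeff_charpolyRev_rowTrunc_succ T r k
      -- The term `j = k` carries the constant coefficient `1`; it is the separate `V (k + 1) r` of
      -- the recursion, which is why the remaining sum stops at `k`.
      rw [Finset.sum_range_succ] at e
      simp only [Nat.sub_self, charpolyRev_coeff_zero, mul_one] at e
      rw [hf' k hk, e, hf _ hk, ← hVp (k + 1) hk r, Finset.sum_congr rfl fun j hj => ?_]
      · ring
      · have hj' := Finset.mem_range.mp hj
        rw [ihk (k - j) (by omega) (by omega), ← hVp (j + 1) (by omega) r]

theorem charpolyRev_coeff_eq [Nontrivial R] (T : Matrix (Fin q) (Fin q) R) {k : ℕ} (hk : k ≤ q) :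
    T.charpolyRev.coeff k = T.charpoly.coeff (q - k) := by
  rw [← Matrix.reverse_charpoly, Polynomial.coeff_reverse, Matrix.charpoly_natDegree_eq_dim,
    Fintype.card_fin, Polynomial.revAt_le hk]

theorem charpolyRev_coeff_of_lt (T : Matrix (Fin q) (Fin q) R) {k : ℕ} (hk : q < k) :
    T.charpolyRev.coeff k = 0 := by
  nontriviality R
  apply Polynomial.coeff_eq_zero_of_natDegree_lt
  rw [← Matrix.reverse_charpoly]
  refine (Polynomial.reverse_natDegree_le _).trans_lt ?_
  rwa [Matrix.charpoly_natDegree_eq_dim, Fintype.card_fin]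

/-- The intermediate results of Horner's rule for `∑ k ≤ q, a k • T ^ (q - k)`. -/
def horner (T : Matrix (Fin q) (Fin q) R) (a : ℕ → R) : ℕ → Matrix (Fin q) (Fin q) R
  | 0 => 0
  | k + 1 => T * horner T a k + a k • 1

theorem horner_eq_sum (T : Matrix (Fin q) (Fin q) R) (a : ℕ → R) (n : ℕ) :
    horner T a (n + 1) = ∑ k ∈ Finset.range (n + 1), a k • T ^ (n - k) := by
  induction n with
  | zero => simp [horner]
  | succ n ih =>
    rw [Finset.sum_range_succ, horner, ih, Finset.mul_sum]
    congr 1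
    · refine Finset.sum_congr rfl fun k hk => ?_
      have := Finset.mem_range.mp hk
      rw [Matrix.mul_smul, ← pow_succ', show n + 1 - k = n - k + 1 by omega]
    · simp

theorem commute_horner (T : Matrix (Fin q) (Fin q) R) (a : ℕ → R) (n : ℕ) :
    Commute T (horner T a n) := by
  induction n with
  | zero => exact Commute.zero_right _
  | succ n ih =>
    exact ((Commute.refl T).mul_right ih).add_right ((Commute.one_right T).smul_right _)

/-- Cayley–Hamilton: the coefficient at `X ^ k` of the reversed polynomial belongs to `T ^ (q - k)`.
-/
theorem horner_charpolyRev (T : Matrix (Fin q) (Fin q) R) :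
    horner T T.charpolyRev.coeff (q + 1) = 0 := by
  nontriviality R
  rw [← Matrix.aeval_self_charpoly T, horner_eq_sum,
    Polynomial.aeval_eq_sum_range' (n := q + 1)
      (by rw [Matrix.charpoly_natDegree_eq_dim, Fintype.card_fin]; omega),
    ← Finset.sum_range_reflect]
  refine Finset.sum_congr rfl fun k hk => ?_
  have := Finset.mem_range.mp hk
  rw [charpolyRev_coeff_eq T (by omega), show q + 1 - 1 - k = q - k by omega,
    show q - (q - k) = k by omega]

end Charpoly

/-! ### Group inverses -/

/-- `S` is the group inverse of `T`. -/
structure IsGroupInverse {A : Type*} [Ring A] (T S : A) : Prop where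
  comm : T * S = S * T
  left : T * S * T = T
  right : S * T * S = S

/-! ### Rank idempotents, and the group inverse from the characteristic polynomial -/

section RankPolynomial

open Polynomial Matrix

variable {R : Type*} [CommRing R] {q : ℕ}

/-- `1 - P + x P` acts as `1` on `Ker P` and as `x` on `Im P`, hence is multiplicative in `x`. -/
theorem det_one_sub_add_smul_mul {P : Matrix (Fin q) (Fin q) R} (hP : P * P = P) (x y : R) :
    (1 - P + x • P).det * (1 - P + y • P).det = (1 - P + (x * y) • P).det := by
  rw [← Matrix.det_mul]
  congr 1
  simp only [mul_add, add_mul, mul_sub, sub_mul, Matrix.mul_smul, Matrix.smul_mul, hP, mul_one,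
    one_mul, smul_smul, mul_comm y x]
  abel

/-- The polynomial `det (1 - P + X P)` of an idempotent matrix `P`; the coefficient at `X ^ k` is
the idempotent of the locus where `P` has rank `k`. -/
noncomputable def rankPoly (P : Matrix (Fin q) (Fin q) R) : R[X] :=
  (1 - P.map C + (X : R[X]) • P.map C).det

theorem aeval_rankPoly {A : Type*} [CommRing A] [Algebra R A] (P : Matrix (Fin q) (Fin q) R)
    (x : A) : aeval x (rankPoly P) =
      (1 - P.map (algebraMap R A) + x • P.map (algebraMap R A)).det := by
  rw [rankPoly, ← AlgHom.coe_toRingHom, RingHom.map_det]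
  congr 1
  ext i j
  by_cases h : i = j <;> simp [h, mul_comm x]

/-- Multiplicativity of the rank polynomial, read in two independent variables. The identity says
that its coefficients are orthogonal idempotents. -/
theorem C_coeff_mul_rankPoly {P : Matrix (Fin q) (Fin q) R} (hP : P * P = P) (j : ℕ) :
    C ((rankPoly P).coeff j) * rankPoly P = C ((rankPoly P).coeff j) * X ^ j := by
  have hP' : P.map (algebraMap R R[X][X]) * P.map (algebraMap R R[X][X]) =
      P.map (algebraMap R R[X][X]) := by
    rw [← Matrix.map_mul, hP]
  -- `C X` is the inner variable and `X` the outer one; the coefficients of the outer `X ^ j` are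
  -- compared.
  have h := det_one_sub_add_smul_mul hP' (C X) X
  rw [← aeval_rankPoly, ← aeval_rankPoly, ← aeval_rankPoly] at h
  have h1 : ∀ p : R[X], aeval (C X : R[X][X]) p = C p := by
    intro p
    induction p using Polynomial.induction_on' with
    | add p r hp hr => simp [hp, hr]
    | monomial n a => simp [← C_mul_X_pow_eq_monomial,
        Polynomial.algebraMap_apply]
  have h2 : ∀ p : R[X], (aeval (X : R[X][X]) p).coeff j = C (p.coeff j) := by
    intro p
    induction p using Polynomial.induction_on' with
    | add p r hp hr => simp [hp, hr]
    | monomial n a =>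
      simp only [aeval_monomial, Polynomial.algebraMap_apply, algebraMap_eq, coeff_C_mul,
        coeff_X_pow, coeff_monomial]
      by_cases hjn : j = n
      · simp [hjn]
      · simp [hjn, Ne.symm hjn]
  have h3 : ∀ p : R[X], (aeval (C X * X : R[X][X]) p).coeff j = C (p.coeff j) * X ^ j := by
    intro p
    induction p using Polynomial.induction_on' with
    | add p r hp hr => simp [hp, hr, add_mul]
    | monomial n a =>
      simp only [aeval_monomial, Polynomial.algebraMap_apply, algebraMap_eq, coeff_C_mul,
        mul_pow, ← C_pow, coeff_X_pow, coeff_monomial]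
      by_cases hjn : j = n
      · simp [hjn]
      · simp [hjn, Ne.symm hjn]
  have h4 := congrArg (fun p => p.coeff j) h
  simp only [h1, coeff_C_mul, h2, h3] at h4
  rw [mul_comm, h4]

theorem eval_one_rankPoly (P : Matrix (Fin q) (Fin q) R) : (rankPoly P).eval 1 = 1 := by
  have h := aeval_rankPoly (A := R) P 1
  rw [← Polynomial.coe_aeval_eq_eval, h]
  simp

/-- On the image of `t s`, where `t` and `s` are inverse to each other, this is `x (1 - x t) = (-x)
t (x - s)`; on the kernel `t` and `s` vanish and both sides are `x`. -/
theorem IsGroupInverse.pow_mul_det {t s : Matrix (Fin q) (Fin q) R} (h : IsGroupInverse t s)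
    (x : R) : x ^ q * (1 - x • t).det =
      (1 - t * s + (-x) • (t * s)).det * (1 - t * s + t).det * (x • 1 - s).det := by
  have hx : x ^ q = (x • (1 : Matrix (Fin q) (Fin q) R)).det := by simp
  rw [hx, ← Matrix.det_mul, ← Matrix.det_mul, ← Matrix.det_mul]
  congr 1
  have e6 : t * s * (t * s) = t * s := by rw [← mul_assoc, h.left]
  have e7 : t * s * s = s := by rw [h.comm, h.right]
  have e9 : (1 - t * s + (-x) • (t * s)) * (1 - t * s + t) = 1 - t * s - x • t := by
    simp only [mul_add, add_mul, mul_sub, sub_mul, Matrix.smul_mul, e6, h.left, mul_one, one_mul,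
      neg_smul, neg_mul]
    abel
  rw [e9]
  simp only [mul_sub, sub_mul, Matrix.smul_mul, Matrix.mul_smul, e7, mul_one, one_mul]
  abel

theorem IsGroupInverse.X_pow_mul_charpolyRev {T S : Matrix (Fin q) (Fin q) R}
    (h : IsGroupInverse T S) : X ^ q * T.charpolyRev =
      aeval (-X : R[X]) (rankPoly (T * S)) * C (1 - T * S + T).det * S.charpoly := by
  have hm : ∀ A B : Matrix (Fin q) (Fin q) R, (A * B).map C = A.map C * B.map C :=
    fun A B => Matrix.map_mul
  have hC : IsGroupInverse (T.map C) (S.map C) :=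
    ⟨by rw [← hm, ← hm, h.comm], by rw [← hm, ← hm, h.left], by rw [← hm, ← hm, h.right]⟩
  have e4 : (C : R →+* R[X]).mapMatrix (1 - T * S + T) = 1 - T.map C * S.map C + T.map C := by
    rw [map_add, map_sub, map_one, map_mul]
    rfl
  have e5 : S.charmatrix = (X : R[X]) • 1 - S.map C := by
    rw [Matrix.charmatrix, Matrix.smul_one_eq_diagonal]
    rfl
  rw [aeval_rankPoly, RingHom.map_det, Matrix.charpoly, Matrix.charpolyRev, e4, e5, algebraMap_eq,
    hm]
  exact hC.pow_mul_det X

/-- After multiplication by `e j` the factor `rankPoly` at `-X` becomes `(-X) ^ j`. What remains is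
a unit times the characteristic polynomial of `S`, monic of degree `q`; so `det (1 - X T)` has
degree `j` and invertible leading coefficient on this component. -/
theorem IsGroupInverse.coeff_mul_charpolyRev_coeff {T S : Matrix (Fin q) (Fin q) R}
    (h : IsGroupInverse T S) (j : ℕ) :
    (∀ i, j < i → (rankPoly (T * S)).coeff j * T.charpolyRev.coeff i = 0) ∧
      ∃ w, (rankPoly (T * S)).coeff j * T.charpolyRev.coeff j * w =
        (rankPoly (T * S)).coeff j := by
  nontriviality R
  have hP : T * S * (T * S) = T * S := by rw [← mul_assoc, h.left]
  have h1 : C ((rankPoly (T * S)).coeff j) * aeval (-X : R[X]) (rankPoly (T * S)) =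
      C ((rankPoly (T * S)).coeff j) * (-X) ^ j := by
    have := congrArg (aeval (-X : R[X])) (C_coeff_mul_rankPoly hP j)
    simpa only [map_mul, map_pow, aeval_C, aeval_X, algebraMap_eq] using this
  set e := (rankPoly (T * S)).coeff j
  have h2 : X ^ q * (C e * T.charpolyRev) =
      X ^ j * (C (e * (-1) ^ j * (1 - T * S + T).det) * S.charpoly) := by
    rw [mul_left_comm, h.X_pow_mul_charpolyRev, ← mul_assoc, ← mul_assoc, h1, neg_pow]
    simp only [map_mul, map_pow, map_neg, map_one]
    ring
  have h3 : ∀ i, j ≤ i → e * T.charpolyRev.coeff i =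
      e * (-1) ^ j * (1 - T * S + T).det * S.charpoly.coeff (q + (i - j)) := by
    intro i hi
    have := congrArg (fun p => p.coeff (i + q)) h2
    rw [Polynomial.coeff_X_pow_mul, Polynomial.coeff_C_mul,
      show i + q = (q + (i - j)) + j by omega, Polynomial.coeff_X_pow_mul,
      Polynomial.coeff_C_mul] at this
    exact this
  have hdeg : S.charpoly.natDegree = q := by
    rw [Matrix.charpoly_natDegree_eq_dim, Fintype.card_fin]
  -- `1 - T S + S` is inverse to `1 - T S + T`.
  refine ⟨fun i hi => ?_, (-1) ^ j * (1 - T * S + S).det, ?_⟩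
  · rw [h3 i hi.le, Polynomial.coeff_eq_zero_of_natDegree_lt (by omega), mul_zero]
  · have hu : (1 - T * S + T).det * (1 - T * S + S).det = 1 := by
      rw [← Matrix.det_mul]
      have e7 : T * S * S = S := by rw [h.comm, h.right]
      have e8 : T * (T * S) = T := by rw [h.comm, ← mul_assoc, h.left]
      have : (1 - T * S + T) * (1 - T * S + S) = 1 := by
        simp only [mul_add, add_mul, mul_sub, sub_mul, hP, e7, e8, mul_one, one_mul]
        abel
      rw [this, Matrix.det_one]
    have hone : S.charpoly.coeff q = 1 := by
      have := (Matrix.charpoly_monic S).coeff_natDegree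
      rwa [hdeg] at this
    rw [h3 j le_rfl, Nat.sub_self, Nat.add_zero, hone, mul_one]
    have : ((-1 : R) ^ j) * (-1) ^ j = 1 := by rw [← mul_pow]; simp
    linear_combination e * hu * ((-1 : R) ^ j * (-1) ^ j) + e * this

/-- Only the component `e k` contributes to `d * a k`: for `j < k` the coefficient `a k` vanishes on
`e j`, and for `j > k` the hypothesis kills `d * a j` with `a j` invertible on `e j`, so `d`
vanishes there. On `e k` the factor `a k` is invertible. -/
theorem IsGroupInverse.mem_span_sq {T S : Matrix (Fin q) (Fin q) R} (h : IsGroupInverse T S)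
    {d : R} (hd : d * d = d) {k : ℕ} (hk : ∀ j, k < j → d * T.charpolyRev.coeff j = 0) :
    d * T.charpolyRev.coeff k ∈
      Ideal.span {d * T.charpolyRev.coeff k * (d * T.charpolyRev.coeff k)} := by
  set a := T.charpolyRev.coeff with ha
  set e := (rankPoly (T * S)).coeff with he
  have hsum : ∑ j ∈ Finset.range ((rankPoly (T * S)).natDegree + 1), e j = 1 := by
    rw [← eval_one_rankPoly (T * S), Polynomial.eval_eq_sum_range]
    simp [he]
  have h1 : d * a k = e k * (d * a k) := by
    calc d * a k = ∑ j ∈ Finset.range ((rankPoly (T * S)).natDegree + 1), e j * (d * a k) := by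
          rw [← Finset.sum_mul, hsum, one_mul]
      _ = e k * (d * a k) := by
          refine Finset.sum_eq_single k (fun j _ hj => ?_) (fun hk => ?_)
          · rcases lt_or_gt_of_ne hj with hj | hj
            · linear_combination d * (h.coeff_mul_charpolyRev_coeff j).1 k hj
            · obtain ⟨w, hw⟩ := (h.coeff_mul_charpolyRev_coeff j).2
              linear_combination -(d * a k) * hw + e j * a k * w * hk j hj
          · have : e k = 0 := Polynomial.coeff_eq_zero_of_natDegree_lt (by
              simpa [Nat.lt_succ_iff] using hk)
            rw [this, zero_mul]
  obtain ⟨w, hw⟩ := (h.coeff_mul_charpolyRev_coeff k).2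
  rw [Ideal.mem_span_singleton']
  refine ⟨w, ?_⟩
  linear_combination (a k * a k * w) * hd + (a k * w - 1) * h1 + d * a k * hw

theorem IsGroupInverse.pow_mul_pow_succ {A : Type*} [Ring A] {T S : A} (h : IsGroupInverse T S)
    (m : ℕ) : S ^ m * T ^ (m + 1) = T := by
  induction m with
  | zero => simp
  | succ m ih =>
    rw [pow_succ, pow_succ' T (m + 1), mul_assoc, ← mul_assoc S T, ← h.comm, pow_succ' T m,
      ← mul_assoc (T * S), h.left, ← pow_succ', ih]

/-- Beyond step `k + 1`, Horner's rule only multiplies by `T` on the component `c`, so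
Cayley–Hamilton says that `T ^ (q - k)` kills the result. The group inverse cancels all powers of
`T` but one. -/
theorem IsGroupInverse.smul_mul_horner {T S : Matrix (Fin q) (Fin q) R}
    (h : IsGroupInverse T S) {c : R} {k : ℕ} (hk : k ≤ q)
    (hc : ∀ j, k < j → c * T.charpolyRev.coeff j = 0) :
    c • (T * horner T T.charpolyRev.coeff (k + 1)) = 0 := by
  have h1 : ∀ m, c • horner T T.charpolyRev.coeff (k + 1 + m) =
      c • (T ^ m * horner T T.charpolyRev.coeff (k + 1)) := by
    intro m
    induction m with
    | zero => simp
    | succ m ih =>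
      rw [← Nat.add_assoc, horner, smul_add, smul_smul, hc _ (by omega), zero_smul, add_zero,
        ← Matrix.mul_smul, ih, Matrix.mul_smul, ← mul_assoc, ← pow_succ']
  have h2 := h1 (q - k)
  rw [show k + 1 + (q - k) = q + 1 by omega, horner_charpolyRev, smul_zero] at h2
  have h3 := congrArg (fun Z => S ^ (q - k) * T * Z) h2.symm
  simp only [mul_zero, Matrix.mul_smul] at h3
  rwa [← mul_assoc, mul_assoc (S ^ (q - k)), ← pow_succ', h.pow_mul_pow_succ] at h3

/-- The group inverse of `T`, up to a factor `T`, from the coefficients `a k` of the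
characteristic polynomial: `y i` is the inverse of `a (q - i)` on the component of the
spectrum where `T` has rank `q - i`. -/
theorem IsGroupInverse.mul_mul_sum_horner {T S : Matrix (Fin q) (Fin q) R}
    (h : IsGroupInverse T S) (a d b z y : ℕ → R) (ha : ∀ k ≤ q, a k = T.charpolyRev.coeff k)
    (hd0 : d 0 = 1) (hb : ∀ i < q, b i = d i * a (q - i))
    (hz : ∀ i < q, b i ∈ Ideal.span {b i * b i} → b i = z i * (b i * b i))
    (hy : ∀ i < q, y i = z i * b i * z i)
    (hd : ∀ i < q, d (i + 1) = d i - z i * b i * d i) :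
    T * (T * ∑ i ∈ Finset.range q, (-y i) • horner T a (q - i)) = T := by
  have hH : ∀ k ≤ q + 1, horner T a k = horner T T.charpolyRev.coeff k := by
    intro k
    induction k with
    | zero => exact fun _ => rfl
    | succ k ih =>
      intro hk
      rw [horner, horner, ih (by omega), ha k (by omega)]
  -- `d i` is what remains after the ranks above `q - i` have been split off; on the complement the
  -- partial sum already does its work.
  have main : ∀ i ≤ q, d i * d i = d i ∧ (∀ j, q - i < j → d i * T.charpolyRev.coeff j = 0) ∧
      (1 - d i) • T = T * (T * ∑ i ∈ Finset.range i, (-y i) • horner T a (q - i)) := by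
    intro i
    induction i with
    | zero =>
      intro _
      refine ⟨by rw [hd0, one_mul], fun j hj => ?_, by simp [hd0]⟩
      rw [charpolyRev_coeff_of_lt T (by omega), mul_zero]
    | succ i ih =>
      intro hi
      obtain ⟨i1, i2, i3⟩ := ih (by omega)
      have hbi := hb i hi
      rw [ha _ (by omega)] at hbi
      have hmem : b i ∈ Ideal.span {b i * b i} := by
        rw [hbi]
        exact h.mem_span_sq i1 i2
      have hzi := hz i hi hmem
      set k := q - i with hk
      set ak := T.charpolyRev.coeff k with hak
      have hee : z i * b i * (z i * b i) = z i * b i := by linear_combination -z i * hzi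
      have hed : z i * b i * d i = z i * b i := by
        rw [hbi]; linear_combination z i * ak * i1
      have hea : z i * b i * z i * ak = z i * b i := by
        linear_combination (-z i * ak) * hed + hee - z i * b i * z i * hbi
      rw [hd i hi]
      refine ⟨by linear_combination (1 - z i * b i) ^ 2 * i1 + d i * hee, fun j hj => ?_, ?_⟩
      · rcases eq_or_ne j k with rfl | hjk
        · linear_combination hzi + (z i * b i - 1) * hbi
        · have := i2 j (by omega)
          linear_combination (1 - z i * b i) * this
      · rw [Finset.sum_range_succ, mul_add, mul_add, ← i3, hed]
        have hc : ∀ j, k < j → z i * b i * T.charpolyRev.coeff j = 0 := fun j hj => by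
          linear_combination -(T.charpolyRev.coeff j) * hed + z i * b i * i2 j hj
        have h4 := h.smul_mul_horner (by omega) hc
        rw [horner, ← hH k (by omega), mul_add, smul_add, Matrix.mul_smul, smul_smul,
          mul_one] at h4
        have h5 := congrArg (fun Z => z i • Z) h4
        simp only [smul_add, smul_smul, smul_zero] at h5
        rw [show z i * (z i * b i * T.charpolyRev.coeff k) = z i * b i by
            linear_combination hea,
          show z i * (z i * b i) = y i by rw [hy i hi]; ring] at h5
        rw [Matrix.mul_smul, Matrix.mul_smul, neg_smul, ← hk, eq_neg_of_add_eq_zero_left h5,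
          neg_neg, ← add_smul]
        congr 1
        ring
  obtain ⟨-, m2, m3⟩ := main q le_rfl
  -- The rank `0` part needs no test: since `a 0 = 1`, the case `k = 0` says that `T` vanishes on
  -- it.
  have h6 := h.smul_mul_horner (Nat.zero_le q) (c := d q) (fun j hj => m2 j (by omega))
  rw [horner, horner, mul_zero, zero_add, charpolyRev_coeff_zero, one_smul, mul_one] at h6
  rw [← m3, sub_smul, h6, one_smul, sub_zero]

end RankPolynomial

/-! ### Crossed maps and group inverses -/

section CrossedGroupInverse

variable {R E F G : Type*} [CommRing R] [AddCommGroup E] [Module R E]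
  [AddCommGroup F] [Module R F] [AddCommGroup G] [Module R G] {p q r : ℕ}

section

variable {φ : E →ₗ[R] F} {φ' : F →ₗ[R] E} (h : Crossed φ φ')

theorem Ig_apply_of_mem_ker {y : F} (hy : φ' y = 0) : Ig φ φ' h y = 0 := by
  have : Submodule.projectionOnto (LinearMap.range φ) (LinearMap.ker φ') h.1 y = 0 := by
    rw [Submodule.projectionOnto_apply_eq_zero_iff]
    exact hy
  simp [Ig, this]

theorem Ig_apply_map (y : F) : Ig φ φ' h (φ (φ' y)) = φ' y := by
  have h1 : Submodule.projectionOnto (LinearMap.range φ) (LinearMap.ker φ') h.1 (φ (φ' y)) =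
      crossedRestrict φ φ' ⟨φ' y, LinearMap.mem_range_self φ' y⟩ :=
    Submodule.projectionOnto_apply_left h.1 (crossedRestrict φ φ' ⟨φ' y, _⟩)
  have h2 := (LinearEquiv.ofBijective (crossedRestrict φ φ')
    (crossedRestrict_bijective h)).symm_apply_apply ⟨φ' y, LinearMap.mem_range_self φ' y⟩
  rw [LinearEquiv.ofBijective_apply] at h2
  simp [Ig, h1, h2]

/-- `Im φ = Im (φ ∘ φ')`, because `E = Ker φ + Im φ'`. Hence `Ig` is determined by its values on `φ
(φ' z)` and on `Ker φ'`. -/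
theorem exists_eq_add_of_crossed (h : Crossed φ φ') (y : F) :
    ∃ z k, y = φ (φ' z) + k ∧ φ' k = 0 := by
  have hy : y ∈ LinearMap.range φ ⊔ LinearMap.ker φ' := by rw [h.1.sup_eq_top]; trivial
  obtain ⟨_, ⟨x, rfl⟩, k, hk, rfl⟩ := Submodule.mem_sup.mp hy
  have hx : x ∈ LinearMap.ker φ ⊔ LinearMap.range φ' := by rw [h.2.sup_eq_top]; trivial
  obtain ⟨l, hl, _, ⟨z, rfl⟩, rfl⟩ := Submodule.mem_sup.mp hx
  exact ⟨z, k, by rw [map_add, LinearMap.mem_ker.mp hl, zero_add], hk⟩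

theorem Ig_comp_comp : Ig φ φ' h ∘ₗ φ ∘ₗ φ' = φ' :=
  LinearMap.ext (Ig_apply_map h)

theorem map_comp_Ig : φ' ∘ₗ φ ∘ₗ Ig φ φ' h = φ' := by
  ext y
  obtain ⟨z, k, rfl, hk⟩ := exists_eq_add_of_crossed h y
  simp [Ig_apply_map, Ig_apply_of_mem_ker h hk, hk]

theorem Ig_comp_map_comp_Ig : Ig φ φ' h ∘ₗ φ ∘ₗ Ig φ φ' h = Ig φ φ' h := by
  ext y
  obtain ⟨z, k, rfl, hk⟩ := exists_eq_add_of_crossed h y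
  simp [Ig_apply_map, Ig_apply_of_mem_ker h hk]

theorem map_comp_Ig_comp_map : φ ∘ₗ Ig φ φ' h ∘ₗ φ = φ := by
  ext x
  have hx : x ∈ LinearMap.ker φ ⊔ LinearMap.range φ' := by rw [h.2.sup_eq_top]; trivial
  obtain ⟨l, hl, _, ⟨z, rfl⟩, rfl⟩ := Submodule.mem_sup.mp hx
  simp [Ig_apply_map, LinearMap.mem_ker.mp hl]

end

/-- `φ φ' s` and `φ' s φ` supply the decompositions of `F` and `E`; `h₂` and `h₃` make the two
intersections trivial. -/
theorem crossed_of_comp_eq {φ : E →ₗ[R] F} {φ' : F →ₗ[R] E} (s : F →ₗ[R] F)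
    (h₁ : φ ∘ₗ φ' ∘ₗ s ∘ₗ φ = φ) (h₂ : s ∘ₗ φ ∘ₗ φ' ∘ₗ φ = φ) (h₃ : φ' ∘ₗ s ∘ₗ φ ∘ₗ φ' = φ')
    (h₄ : φ' ∘ₗ φ ∘ₗ φ' ∘ₗ s = φ') : Crossed φ φ' := by
  have h₁' := fun x => LinearMap.congr_fun h₁ x
  have h₂' := fun x => LinearMap.congr_fun h₂ x
  have h₃' := fun x => LinearMap.congr_fun h₃ x
  have h₄' := fun x => LinearMap.congr_fun h₄ x
  simp only [LinearMap.comp_apply] at h₁' h₂' h₃' h₄'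
  refine ⟨IsCompl.of_eq ?_ ?_, IsCompl.of_eq ?_ ?_⟩
  · rw [Submodule.eq_bot_iff]
    rintro _ ⟨⟨x, rfl⟩, hx⟩
    rw [← h₂' x, show φ' (φ x) = 0 from hx, map_zero, map_zero]
  · rw [Submodule.eq_top_iff']
    intro y
    refine Submodule.mem_sup.mpr ⟨φ (φ' (s y)), ⟨_, rfl⟩, y - φ (φ' (s y)), ?_, by abel⟩
    rw [LinearMap.mem_ker, map_sub, h₄', sub_self]
  · rw [Submodule.eq_bot_iff]
    rintro _ ⟨hx, ⟨y, rfl⟩⟩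
    rw [← h₃' y, show φ (φ' y) = 0 from hx, map_zero, map_zero]
  · rw [Submodule.eq_top_iff']
    intro x
    refine Submodule.mem_sup.mpr ⟨x - φ' (s (φ x)), ?_, φ' (s (φ x)), ⟨_, rfl⟩, by abel⟩
    rw [LinearMap.mem_ker, map_sub, h₁', sub_self]

/-! ### Matrices of linear maps between projective modules -/

theorem ProjData.proj_comp_incl (D : ProjData R E p) : D.proj ∘ₗ D.incl = LinearMap.id := by
  ext x
  obtain ⟨v, hv⟩ := (D.equiv x).2
  have : D.mat.mulVecLin.rangeRestrict (D.equiv x : Fin p → R) = D.equiv x := by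
    apply Subtype.ext
    change D.mat.mulVecLin (D.equiv x : Fin p → R) = D.equiv x
    rw [← hv, Matrix.mulVecLin_apply, Matrix.mulVecLin_apply, Matrix.mulVec_mulVec, D.idem]
  simp [ProjData.proj, ProjData.incl, this]

theorem repMatrix_comp (DE : ProjData R E p) (DF : ProjData R F q) (DG : ProjData R G r)
    (ψ : F →ₗ[R] G) (φ : E →ₗ[R] F) :
    repMatrix DE DG (ψ ∘ₗ φ) = repMatrix DF DG ψ * repMatrix DE DF φ := by
  rw [repMatrix, repMatrix, repMatrix, ← LinearMap.toMatrix'_comp]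
  congr 1
  calc DG.incl ∘ₗ (ψ ∘ₗ φ) ∘ₗ DE.proj
      = DG.incl ∘ₗ ψ ∘ₗ LinearMap.id ∘ₗ φ ∘ₗ DE.proj := rfl
    _ = _ := by rw [← DF.proj_comp_incl]; rfl

theorem repMatrix_injective (DE : ProjData R E p) (DF : ProjData R F q) :
    Function.Injective (repMatrix DE DF) := by
  intro φ ψ h
  have h1 : DF.incl ∘ₗ φ ∘ₗ DE.proj = DF.incl ∘ₗ ψ ∘ₗ DE.proj :=
    LinearMap.toMatrix'.injective h
  have h2 : ∀ χ : E →ₗ[R] F, DF.proj ∘ₗ (DF.incl ∘ₗ χ ∘ₗ DE.proj) ∘ₗ DE.incl = χ := by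
    intro χ
    calc _ = (DF.proj ∘ₗ DF.incl) ∘ₗ χ ∘ₗ (DE.proj ∘ₗ DE.incl) := rfl
      _ = χ := by rw [DF.proj_comp_incl, DE.proj_comp_incl]; rfl
  rw [← h2 φ, h1, h2]

/-- `S` acts on `R ^ q` and need not respect `F`. Compressing it to `P S P` changes nothing, since
`P M = M` and `M' P = M'`. -/
theorem crossed_of_matrix {DE : ProjData R E p} {DF : ProjData R F q} {φ : E →ₗ[R] F}
    {φ' : F →ₗ[R] E} {M : Matrix (Fin q) (Fin p) R} {M' : Matrix (Fin p) (Fin q) R}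
    (hM : M = repMatrix DE DF φ) (hM' : M' = repMatrix DF DE φ') {S : Matrix (Fin q) (Fin q) R}
    (hS : Commute (M * M') S) (h₁ : M * M' * S * M = M) (h₂ : M' * (M * M' * S) = M') :
    Crossed φ φ' := by
  set P := repMatrix DF DF LinearMap.id with hP
  have hPM : P * M = M := by rw [hM, hP, ← repMatrix_comp, LinearMap.id_comp]
  have hMP : M' * P = M' := by rw [hM', hP, ← repMatrix_comp, LinearMap.comp_id]
  have hs : repMatrix DF DF (DF.proj ∘ₗ Matrix.toLin' S ∘ₗ DF.incl) = P * S * P := by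
    conv_rhs => rw [← LinearMap.toMatrix'_toLin' S]
    rw [hP, repMatrix, repMatrix, ← LinearMap.toMatrix'_comp, ← LinearMap.toMatrix'_comp]
    rfl
  have hS' := hS.eq
  refine crossed_of_comp_eq (DF.proj ∘ₗ Matrix.toLin' S ∘ₗ DF.incl) ?_ ?_ ?_ ?_
  · apply repMatrix_injective DE DF
    rw [repMatrix_comp DE DE DF, repMatrix_comp DE DF DE, repMatrix_comp DE DF DF, hs, ← hM, ← hM']
    calc M * (M' * (P * S * P * M)) = M * ((M' * P) * S * (P * M)) := by
          simp only [Matrix.mul_assoc]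
      _ = M := by rw [hPM, hMP, ← Matrix.mul_assoc, ← Matrix.mul_assoc, h₁]
  · apply repMatrix_injective DE DF
    rw [repMatrix_comp DE DF DF, repMatrix_comp DE DE DF, repMatrix_comp DE DF DE, hs, ← hM, ← hM']
    calc P * S * P * (M * (M' * M)) = P * (S * (P * M * M')) * M := by
          simp only [Matrix.mul_assoc]
      _ = P * M * M' * S * M := by rw [hPM, ← hS']; simp only [← Matrix.mul_assoc, hPM]
      _ = M := by rw [hPM, h₁]
  · apply repMatrix_injective DF DE
    rw [repMatrix_comp DF DF DE, repMatrix_comp DF DF DF, repMatrix_comp DF DE DF, hs, ← hM, ← hM']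
    calc M' * (P * S * P * (M * M')) = M' * P * (S * (P * M * M')) := by
          simp only [Matrix.mul_assoc]
      _ = M' := by rw [hPM, hMP, ← hS', h₂]
  · apply repMatrix_injective DF DE
    rw [repMatrix_comp DF DF DE, repMatrix_comp DF DE DF, repMatrix_comp DF DF DE, hs, ← hM, ← hM']
    calc M' * (M * (M' * (P * S * P))) = M' * (M * (M' * P) * S) * P := by
          simp only [Matrix.mul_assoc]
      _ = M' := by rw [hMP, h₂, hMP]

theorem Crossed.exists_groupInverse {φ : E →ₗ[R] F} {φ' : F →ₗ[R] E} (h : Crossed φ φ')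
    (DE : ProjData R E p) (DF : ProjData R F q) {M : Matrix (Fin q) (Fin p) R}
    {M' : Matrix (Fin p) (Fin q) R} (hM : M = repMatrix DE DF φ) (hM' : M' = repMatrix DF DE φ') :
    ∃ S, IsGroupInverse (M * M') S ∧ M * M' * S * M = M ∧ M' * (S * (M * M')) = M' ∧
      M' * S = repMatrix DF DE (Ig φ φ' h) ∧ S * M = repMatrix DE DF (Ig φ' φ h.symm) := by
  set N := repMatrix DF DE (Ig φ φ' h) with hN
  set N' := repMatrix DE DF (Ig φ' φ h.symm) with hN'
  have a1 : N * (M * M') = M' := by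
    rw [hM, hM', hN, ← repMatrix_comp, ← repMatrix_comp, Ig_comp_comp]
  have a2 : M' * (M * N) = M' := by
    rw [hM, hM', hN, ← repMatrix_comp, ← repMatrix_comp, map_comp_Ig]
  have a3 : N * (M * N) = N := by
    rw [hM, hN, ← repMatrix_comp, ← repMatrix_comp, Ig_comp_map_comp_Ig]
  have a4 : M * (N * M) = M := by
    rw [hM, hN, ← repMatrix_comp, ← repMatrix_comp, map_comp_Ig_comp_map]
  have b1 : N' * (M' * M) = M := by
    rw [hM, hM', hN', ← repMatrix_comp, ← repMatrix_comp, Ig_comp_comp h.symm]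
  have b2 : M * (M' * N') = M := by
    rw [hM, hM', hN', ← repMatrix_comp, ← repMatrix_comp, map_comp_Ig h.symm]
  have b3 : N' * (M' * N') = N' := by
    rw [hM', hN', ← repMatrix_comp, ← repMatrix_comp, Ig_comp_map_comp_Ig h.symm]
  -- Both sides represent the projection of `F` onto `Im φ` along `Ker φ'`; in `c2` it is that of
  -- `E` onto `Im φ'` along `Ker φ`. They make `N' * N` the group inverse.
  have c1 : M * N = N' * M' := by
    conv_lhs => rw [← b1]
    rw [Matrix.mul_assoc, Matrix.mul_assoc, a2]
  have c2 : N * M = M' * N' := by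
    conv_lhs => rw [← b2]
    rw [← Matrix.mul_assoc M, ← Matrix.mul_assoc, a1]
  have d1 : M * M' * (N' * N) = M * N := by
    rw [← Matrix.mul_assoc, Matrix.mul_assoc M, b2]
  have d2 : N' * N * (M * M') = M * N := by
    rw [Matrix.mul_assoc, a1, c1]
  refine ⟨N' * N, ⟨by rw [d1, d2], ?_, ?_⟩, ?_, ?_, ?_, ?_⟩
  · rw [d1, ← Matrix.mul_assoc, Matrix.mul_assoc M N, a4]
  · rw [d2, c1, ← Matrix.mul_assoc, Matrix.mul_assoc N', b3]
  · rw [d1, Matrix.mul_assoc, a4]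
  · rw [d2, a2]
  · rw [← Matrix.mul_assoc, ← c2, Matrix.mul_assoc, a3]
  · rw [Matrix.mul_assoc, c2, b3]

/-- A matrix `Z` that commutes with `T` and satisfies `T ^ 2 Z = T` may replace the group inverse
of `T` in the formulas for the generalized inverses. -/
theorem IsGroupInverse.formulas {M : Matrix (Fin q) (Fin p) R} {M' : Matrix (Fin p) (Fin q) R}
    {T S Z : Matrix (Fin q) (Fin q) R} (h : IsGroupInverse T S) (h₁ : T * S * M = M)
    (h₂ : M' * (S * T) = M') (hc : Commute T Z) (hZ : T * (T * Z) = T) :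
    T * Z * M = M ∧ M' * (T * Z) = M' ∧ M' * Z = M' * S ∧ Z * M = S * M := by
  have e1 : T * Z * T = T := by rw [mul_assoc, ← hc.eq, hZ]
  have e2 : S * (T * Z) = S := by
    conv_lhs => rw [← h.right, mul_assoc S, h.comm, mul_assoc, mul_assoc, hZ]
    rw [← h.comm, ← mul_assoc, h.right]
  have e3 : T * Z * S = S := by
    conv_lhs => rw [← h.right, ← h.comm, mul_assoc T S S, ← mul_assoc, e1]
    rw [← mul_assoc, h.comm, h.right]
  refine ⟨?_, ?_, ?_, ?_⟩
  · conv_lhs => rw [← h₁]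
    rw [← Matrix.mul_assoc, ← Matrix.mul_assoc, e1, h₁]
  · conv_lhs => rw [← h₂]
    rw [Matrix.mul_assoc, mul_assoc S, hZ, h₂]
  · conv_lhs => rw [← h₂]
    rw [Matrix.mul_assoc, mul_assoc S, e2]
  · conv_lhs => rw [← h₁]
    rw [← Matrix.mul_assoc, ← mul_assoc, ← hc.eq, e3]

end CrossedGroupInverse

namespace RingProg

/-! ### The programs -/

/-- The entry of the array `a` whose row and column are in the registers `k` and `l`. -/
abbrev entry (a k l : ℕ) : Ref := ⟨a, .reg k, .reg l⟩

/-- The entry `(0, 0)` of the array `a`. -/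
abbrev scalar (a : ℕ) : Ref := ⟨a, .const 0, .const 0⟩

/-- Run `c` for all entries `(i, j)` of a matrix, with `i` and `j` in the registers `3` and `4`. -/
def forEntries (m n : ℕ) (c : Prog) : Prog := .loop 3 (.reg m) (.loop 4 (.reg n) c)

/-- Array `d` receives the product of the arrays `x` and `y`; the registers `m`, `n`, `l` hold the
sizes. -/
def matMul (d x y m n l : ℕ) : Prog :=
  forEntries m n (.seq (.zero (entry d 3 4)) (.loop 5 (.reg l)
    (.seq (.mul (scalar 20) (entry x 3 5) (entry y 5 4))
      (.add (entry d 3 4) (entry d 3 4) (scalar 20)))))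

/-- Register `2` is set to `0` unless the matrices in the arrays `x` and `y` are equal. -/
def checkEq (x y m n : ℕ) : Prog :=
  forEntries m n (.seq (.sub (scalar 20) (entry x 3 4) (entry y 3 4))
    (.test (scalar 20) (scalar 21) (scalar 20) .skip (.setIdx 2 (.const 0))))

/-! ### Correctness of the matrix product and of the equality check -/

section

variable {R : Type*} [CommRing R] {δ : R → R → Option R}

theorem run_seq (c₁ c₂ : Prog) (s : State R) :
    run δ (.seq c₁ c₂) s = run δ c₂ (run δ c₁ s) := rfl

/-- The outer bound is read once, but the inner bound is read again in every round; therefore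
register `n` must be protected and register `m` need not be. -/
theorem run_forEntries (d m n : ℕ) (c : Prog) (val : ℕ → ℕ → R → R) (s : State R)
    (hc : 3 ∉ c.regs) (hn : n ∉ 3 :: 4 :: c.regs)
    (hs : ∀ t, Agree (.loop 4 (.reg n) c) 3 s t →
      ∀ a b, (run δ c t).mem d a b =
      if a = t.idx 3 ∧ b = t.idx 4 then val a b (t.mem d a b) else t.mem d a b) (a b : ℕ) :
    (run δ (forEntries m n c) s).mem d a b =
      if a < s.idx m ∧ b < s.idx n then val a b (s.mem d a b) else s.mem d a b := by
  have h := run_loop_update (δ := δ) d (fun _ b => b < s.idx n) (fun a _ => a) val 3 (.reg m)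
    (.loop 4 (.reg n) c) s (fun t ht _ _ a b => by
      have g := run_loop_update (δ := δ) d (fun a _ => a = t.idx 3) (fun _ b => b) val 4 (.reg n) c t
        (fun u hu _ _ a b => by
          have e3 : u.idx 3 = t.idx 3 := hu.idx 3 (by simp [hc])
          have := hs u ⟨fun a ha => (hu.mem a ha).trans (ht.mem a ha), fun r hr =>
            (hu.idx r (fun h => hr (List.mem_cons_of_mem _ h))).trans (ht.idx r hr)⟩ a b
          rw [e3] at this
          exact ⟨fun h h' => by rw [this, if_pos ⟨h, h'⟩], fun h => by rw [this, if_neg h]⟩) a b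
      simp only [IExp.eval, ht.idx n hn] at g
      exact ⟨fun h h' => g.1 h' h, fun h => g.2 fun h' => h h'.symm⟩) a b
  split_ifs with hab
  · exact h.1 hab.2 hab.1
  · exact h.2 fun h' => hab h'.symm

theorem run_matMul (d x y m n l : ℕ) (s : State R) (hd : d ≠ 20) (hx : x ∉ [d, 20])
    (hy : y ∉ [d, 20]) (hn : n ∉ [3, 4, 5]) (hl : l ∉ [3, 4, 5]) (a b : ℕ) :
    (run δ (matMul d x y m n l) s).mem d a b = if a < s.idx m ∧ b < s.idx n then
      ∑ k ∈ Finset.range (s.idx l), s.mem x a k * s.mem y k b else s.mem d a b := by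
  simp only [List.mem_cons, List.not_mem_nil, or_false, not_or] at hx hy hl hn
  refine run_forEntries d m n _
    (fun a b _ => ∑ k ∈ Finset.range (s.idx l), s.mem x a k * s.mem y k b) s
    (by simp [Prog.regs]) (by simp [Prog.regs, hn]) (fun t ht a b => ?_) a b
  have h := run_loop_sum (δ := δ) d (t.idx 3) (t.idx 4)
    (fun k => s.mem x (t.idx 3) k * s.mem y k (t.idx 4)) 5 (.reg l)
    (.seq (.mul (scalar 20) (entry x 3 5) (entry y 5 4))
      (.add (entry d 3 4) (entry d 3 4) (scalar 20))) (run δ (.zero (entry d 3 4)) t)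
    (fun u hu _ _ a' b' => by
      have hu3 := hu.idx 3 (by simp [Prog.regs])
      have hu4 := hu.idx 4 (by simp [Prog.regs])
      have hux := hu.mem x (by simp [Prog.arrays, hx])
      have huy := hu.mem y (by simp [Prog.arrays, hy])
      have htx := ht.mem x (by simp [Prog.arrays, hx])
      have hty := ht.mem y (by simp [Prog.arrays, hy])
      rw [run_mem_of_notMem _ _ (by simp [Prog.arrays, hx])] at hux
      rw [run_mem_of_notMem _ _ (by simp [Prog.arrays, hy])] at huy
      rw [run_idx_of_notMem _ _ (by simp [Prog.regs])] at hu3 hu4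
      simp [run, State.put, State.get, State.countOp, IExp.eval, hd, hu3, hu4, hux, huy, htx, hty])
    a b
  have htl : (run δ (.zero (entry d 3 4)) t).idx l = s.idx l := by
    rw [run_idx_of_notMem _ _ (by simp [Prog.regs])]
    exact ht.idx l (by simp [Prog.regs, hl])
  simp only [IExp.eval, htl] at h
  rw [run, h]
  split_ifs with hab
  · simp [run, State.put, IExp.eval, hab.1, hab.2]
  · simp [run, State.put, IExp.eval, hab]

/-- Divisibility by `0` is the equality test of the machine. -/
theorem IsDivTest.eq_none_iff (hδ : IsDivTest δ) (x : R) : δ x 0 = none ↔ x ≠ 0 := by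
  have h := hδ x 0
  rw [Ideal.mem_span_singleton, zero_dvd_iff] at h
  constructor
  · rintro hn rfl
    obtain ⟨z, hz, -⟩ := h.1 rfl
    simp [hz] at hn
  · exact h.2

-- The array `21` is never written and provides the divisor `0`. The flag is only ever lowered, so
-- consecutive checks form a conjunction.
open Classical in
theorem run_checkEq (hδ : IsDivTest δ) (x y m n : ℕ) (s : State R) (h0 : s.mem 21 0 0 = 0)
    (hx : x ≠ 20) (hy : y ≠ 20) (hn : n ∉ [2, 3, 4]) :
    (run δ (checkEq x y m n) s).idx 2 =
      if ∀ a < s.idx m, ∀ b < s.idx n, s.mem x a b = s.mem y a b then s.idx 2 else 0 := by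
  simp only [List.mem_cons, List.not_mem_nil, or_false, not_or] at hn
  refine run_loop_state (fun i t => t.idx 2 =
    if ∀ a < i, ∀ b < s.idx n, s.mem x a b = s.mem y a b then s.idx 2 else 0) 3 (.reg m) _ s
    (by simp) ?_
  intro i _ t ht hI
  have h := run_loop_state (δ := δ) (fun j u => u.idx 2 =
    if ∀ b < j, s.mem x i b = s.mem y i b then t.idx 2 else 0) 4 (.reg n)
    (.seq (.sub (scalar 20) (entry x 3 4) (entry y 3 4))
      (.test (scalar 20) (scalar 21) (scalar 20) .skip (.setIdx 2 (.const 0)))) (t.putIdx 3 i)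
    (by simp [State.putIdx]) (fun j _ u hu hJ => by
      have hu3 : u.idx 3 = i := by
        rw [hu.idx 3 (by simp [Prog.regs])]; simp [State.putIdx]
      have hux : u.mem x = s.mem x :=
        (hu.mem x (by simp [Prog.arrays, hx])).trans (ht.mem x (by simp [Prog.arrays, hx]))
      have huy : u.mem y = s.mem y :=
        (hu.mem y (by simp [Prog.arrays, hy])).trans (ht.mem y (by simp [Prog.arrays, hy]))
      have hu0 : u.mem 21 0 0 = 0 := by
        rw [hu.mem 21 (by simp [Prog.arrays])]
        exact (congrFun (congrFun (ht.mem 21 (by simp [Prog.arrays])) 0) 0).trans h0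
      have hn' := hδ.eq_none_iff (s.mem x i j - s.mem y i j)
      rw [sub_ne_zero] at hn'
      simp only [Nat.forall_lt_succ_right]
      by_cases hxy : s.mem x i j = s.mem y i j
      · obtain ⟨z, hz⟩ := Option.ne_none_iff_exists'.mp fun h => hn'.mp h hxy
        rw [hxy, sub_self] at hz
        simpa [run, State.put, State.get, State.countOp, State.countTest, State.putIdx, IExp.eval,
          hu3, hux, huy, hu0, hz, hxy] using hJ
      · simp [run, State.put, State.get, State.countOp, State.countTest, State.putIdx, IExp.eval,
          hu3, hux, huy, hu0, hn'.mpr hxy, hxy])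
  have htn : (IExp.reg n).eval (t.putIdx 3 i).idx = s.idx n := by
    simp only [IExp.eval, State.putIdx, hn, if_false]
    exact ht.idx n (by simp [Prog.regs, hn])
  rw [htn] at h
  simp only [Nat.forall_lt_succ_right]
  rw [h, hI]
  split_ifs <;> simp_all

end

/-- Copy the row of the array `6` whose index is in register `6` to the array `7`. -/
def copyRow : Prog := .loop 3 (.reg 1) (.copy (entry 7 6 3) (entry 6 6 3))

/-- The row `0` of the array `8` receives the unit vector given by register `6`. -/
def unitVector : Prog :=
  .seq (.loop 3 (.reg 1) (.zero ⟨8, .const 0, .reg 3⟩)) (.one ⟨8, .const 0, .reg 6⟩)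

/-- The successor of a register. -/
abbrev succReg (k : ℕ) : IExp := .add (.reg k) (.const 1)

/-- Row `k + 1` of the array `8` receives the product of the array `7` with row `k`. -/
def krylov : Prog :=
  .loop 7 (.reg 1) (.loop 3 (.reg 1) (.seq (.zero ⟨8, succReg 7, .reg 3⟩)
    (.loop 5 (.reg 1) (.seq (.mul (scalar 20) (entry 7 3 5) (entry 8 7 5))
      (.add ⟨8, succReg 7, .reg 3⟩ ⟨8, succReg 7, .reg 3⟩ (scalar 20))))))

/-- Division of a truncated power series in the array `9` by the one whose coefficients the array
`8` contains. -/
def divideSeries : Prog :=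
  .seq (.one ⟨9, succReg 6, .const 0⟩)
    (.loop 7 (.reg 1) (.seq
      (.sub ⟨9, succReg 6, succReg 7⟩ ⟨9, .reg 6, succReg 7⟩ ⟨8, succReg 7, .reg 6⟩)
      (.loop 5 (.reg 7) (.seq
        (.mul (scalar 20) ⟨8, succReg 5, .reg 6⟩ ⟨9, succReg 6, .sub (.reg 7) (.reg 5)⟩)
        (.sub ⟨9, succReg 6, succReg 7⟩ ⟨9, succReg 6, succReg 7⟩ (scalar 20))))))

/-- The coefficients of `det (1 - X T)`, where `T` is in the array `6`. -/
def charpolyProg : Prog :=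
  .seq (.one (scalar 9))
    (.loop 6 (.reg 1) (.seq copyRow (.seq unitVector (.seq krylov divideSeries))))

/-- One step in the computation of the rank idempotents. -/
def idempotentStep : Prog :=
  .seq (.mul ⟨11, .reg 6, .const 0⟩ ⟨10, .reg 6, .const 0⟩ ⟨9, .reg 1, .sub (.reg 1) (.reg 6)⟩)
  (.seq (.mul (scalar 20) ⟨11, .reg 6, .const 0⟩ ⟨11, .reg 6, .const 0⟩)
  (.seq (.test ⟨11, .reg 6, .const 0⟩ (scalar 20) ⟨12, .reg 6, .const 0⟩ .skip .skip)
  (.seq (.mul (scalar 22) ⟨12, .reg 6, .const 0⟩ ⟨11, .reg 6, .const 0⟩)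
  (.seq (.mul ⟨13, .reg 6, .const 0⟩ (scalar 22) ⟨12, .reg 6, .const 0⟩)
  (.seq (.mul (scalar 20) (scalar 22) ⟨10, .reg 6, .const 0⟩)
  (.sub ⟨10, succReg 6, .const 0⟩ ⟨10, .reg 6, .const 0⟩ (scalar 20)))))))

/-- The rank idempotents of the matrix in the array `6`. -/
def idempotentProg : Prog := .seq (.one (scalar 10)) (.loop 6 (.reg 1) idempotentStep)

/-- One step of Horner's rule in the array `15`. -/
def hornerStep : Prog :=
  .seq (matMul 14 6 15 1 1 1)
  (.seq (forEntries 1 1 (.copy (entry 15 3 4) (entry 14 3 4)))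
  (.loop 3 (.reg 1) (.add (entry 15 3 3) (entry 15 3 3) (entry 9 1 6))))

/-- Subtract a multiple of the array `15` from the array `16`. -/
def accumulateStep : Prog :=
  forEntries 1 1 (.seq (.mul (scalar 20) ⟨13, .sub (.reg 1) (succReg 6), .const 0⟩ (entry 15 3 4))
    (.sub (entry 16 3 4) (entry 16 3 4) (scalar 20)))

/-- The array `16` receives a substitute for the group inverse of the array `6`. -/
def groupInverseProg : Prog := .loop 6 (.reg 1) (.seq hornerStep accumulateStep)

/-- Set register `2` to `1` if the array `16` satisfies the equations of a group inverse, and to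
`0` otherwise. -/
def verifyProg : Prog :=
  .seq (matMul 17 6 16 1 1 1)
  (.seq (matMul 18 17 2 1 0 1)
  (.seq (matMul 19 3 17 0 1 1)
  (.seq (.setIdx 2 (.const 1))
  (.seq (checkEq 18 2 1 0) (checkEq 19 3 0 1)))))

/-- The program that decides whether two maps are crossed. -/
def crossedProg : Prog :=
  .seq (matMul 6 2 3 1 1 0)
  (.seq charpolyProg (.seq idempotentProg (.seq groupInverseProg verifyProg)))

/-- The program that computes the generalized inverses. -/
def igProg : Prog := .seq (matMul 4 3 16 0 1 1) (matMul 5 16 2 1 0 1)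

/-! ### Correctness of the stages that compute the substitute for the group inverse -/

section

variable {R : Type*} [CommRing R] {δ : R → R → Option R}

theorem run_copyRow (s : State R) (a b : ℕ) : (run δ copyRow s).mem 7 a b =
    if a = s.idx 6 ∧ b < s.idx 1 then s.mem 6 a b else s.mem 7 a b := by
  have h := run_loop_update (δ := δ) 7 (fun a _ => a = s.idx 6) (fun _ b => b)
    (fun a b _ => s.mem 6 a b) 3 (.reg 1) (.copy (entry 7 6 3) (entry 6 6 3)) s
    (fun t ht _ _ a b => by
      have h6 := ht.idx 6 (by simp [Prog.regs])
      have m6 := ht.mem 6 (by simp [Prog.arrays])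
      constructor
      · rintro rfl rfl
        simp [run, State.put, State.get, IExp.eval, h6, m6]
      · intro hab
        simp [run, State.put, IExp.eval, h6, hab]) a b
  split_ifs with hab
  · exact h.1 hab.1 hab.2
  · exact h.2 hab

theorem run_unitVector (s : State R) (b : ℕ) (hb : b < s.idx 1) :
    (run δ unitVector s).mem 8 0 b = if b = s.idx 6 then 1 else 0 := by
  have h := run_loop_update (δ := δ) 8 (fun a _ => a = 0) (fun _ b => b)
    (fun _ _ _ => 0) 3 (.reg 1) (.zero ⟨8, .const 0, .reg 3⟩) s
    (fun t ht _ _ a b => by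
      constructor
      · rintro rfl rfl
        simp [run, State.put, IExp.eval]
      · intro hab
        simp [run, State.put, IExp.eval, hab]) 0 b
  have h6 : (run δ (.loop 3 (.reg 1) (.zero ⟨8, .const 0, .reg 3⟩)) s).idx 6 = s.idx 6 :=
    run_idx_of_notMem _ _ (by simp [Prog.regs])
  replace h := h.1 rfl hb
  rw [unitVector, run_seq]
  generalize run δ (.loop 3 (.reg 1) (.zero ⟨8, .const 0, .reg 3⟩)) s = u at h h6 ⊢
  simp [run, State.put, IExp.eval, h6, h]

/-- Row `k` is final once row `k + 1` is being written, so the recursion can be stated in the final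
memory alone. -/
theorem run_krylov (s : State R) : (∀ b, (run δ krylov s).mem 8 0 b = s.mem 8 0 b) ∧
    ∀ k < s.idx 1, ∀ b < s.idx 1, (run δ krylov s).mem 8 (k + 1) b =
      ∑ j ∈ Finset.range (s.idx 1), s.mem 7 b j * (run δ krylov s).mem 8 k j := by
  refine run_loop_mem (fun i m => (∀ b, m 8 0 b = s.mem 8 0 b) ∧
    ∀ k < i, ∀ b < s.idx 1, m 8 (k + 1) b =
      ∑ j ∈ Finset.range (s.idx 1), s.mem 7 b j * m 8 k j) 7 (.reg 1) _ s (by simp) ?_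
  rintro i hi t ht rfl ⟨hI, hI'⟩
  have t1 : t.idx 1 = s.idx 1 := ht.idx 1 (by simp [Prog.regs])
  have t7 : t.mem 7 = s.mem 7 := ht.mem 7 (by simp [Prog.arrays])
  have h := fun a b => run_loop_update (δ := δ) 8 (fun a _ => a = t.idx 7 + 1) (fun _ b => b)
    (fun _ b _ => ∑ j ∈ Finset.range (s.idx 1), s.mem 7 b j * t.mem 8 (t.idx 7) j) 3 (.reg 1)
    (.seq (.zero ⟨8, succReg 7, .reg 3⟩)
      (.loop 5 (.reg 1) (.seq (.mul (scalar 20) (entry 7 3 5) (entry 8 7 5))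
        (.add ⟨8, succReg 7, .reg 3⟩ ⟨8, succReg 7, .reg 3⟩ (scalar 20))))) t
    (fun u hu hu8 _ a b => by
      have u1 : u.idx 1 = s.idx 1 := (hu.idx 1 (by simp [Prog.regs])).trans t1
      have u7 : u.idx 7 = t.idx 7 := hu.idx 7 (by simp [Prog.regs])
      have m7 : u.mem 7 = s.mem 7 := (hu.mem 7 (by simp [Prog.arrays])).trans t7
      have g := run_loop_sum (δ := δ) 8 (t.idx 7 + 1) (u.idx 3)
        (fun j => s.mem 7 (u.idx 3) j * t.mem 8 (t.idx 7) j) 5 (.reg 1)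
        (.seq (.mul (scalar 20) (entry 7 3 5) (entry 8 7 5))
          (.add ⟨8, succReg 7, .reg 3⟩ ⟨8, succReg 7, .reg 3⟩ (scalar 20)))
        (run δ (.zero ⟨8, succReg 7, .reg 3⟩) u)
        (fun v hv hv8 _ a' b' => by
          have v3 : v.idx 3 = u.idx 3 := hv.idx 3 (by simp [Prog.regs])
          have v7 : v.idx 7 = u.idx 7 := hv.idx 7 (by simp [Prog.regs])
          have w7 : v.mem 7 = u.mem 7 := hv.mem 7 (by simp [Prog.arrays])
          have w8 : ∀ j, v.mem 8 (t.idx 7) j = t.mem 8 (t.idx 7) j := fun j => by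
            rw [hv8 _ _ (by omega), ← hu8 _ _ (by omega)]
            simp [run, State.put, IExp.eval, u7]
          simp [run, State.put, State.get, State.countOp, IExp.eval, v3, v7, w7, w8, u7, m7]) a b
      have hu1 : (run δ (.zero ⟨8, succReg 7, .reg 3⟩) u).idx 1 = s.idx 1 := u1
      simp only [IExp.eval, hu1] at g
      rw [run, g]
      constructor
      · rintro rfl rfl
        simp [run, State.put, IExp.eval, u7]
      · intro hab
        simp [run, State.put, IExp.eval, u7, hab]) a b
  simp only [IExp.eval, t1] at h
  refine ⟨fun b => ?_, fun k hk b hb => ?_⟩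
  · rw [(h 0 b).2 (by simp), hI]
  · have hk' : ∀ j, (run δ (.loop 3 (.reg 1) (.seq (.zero ⟨8, succReg 7, .reg 3⟩)
      (.loop 5 (.reg 1) (.seq (.mul (scalar 20) (entry 7 3 5) (entry 8 7 5))
        (.add ⟨8, succReg 7, .reg 3⟩ ⟨8, succReg 7, .reg 3⟩ (scalar 20)))))) t).mem 8 k j =
        t.mem 8 k j := fun j => (h k j).2 (by omega)
    simp only [hk']
    rcases Nat.lt_succ_iff_lt_or_eq.mp hk with hk | rfl
    · rw [(h (k + 1) b).2 (by omega), hI' k hk b hb]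
    · rw [(h _ b).1 rfl hb]

theorem run_divideSeries (s : State R) :
    (run δ divideSeries s).mem 9 (s.idx 6 + 1) 0 = 1 ∧
    ∀ k < s.idx 1, (run δ divideSeries s).mem 9 (s.idx 6 + 1) (k + 1) =
      s.mem 9 (s.idx 6) (k + 1) - s.mem 8 (k + 1) (s.idx 6) -
        ∑ j ∈ Finset.range k, s.mem 8 (j + 1) (s.idx 6) *
          (run δ divideSeries s).mem 9 (s.idx 6 + 1) (k - j) := by
  set r := s.idx 6 with hr
  set s' := run δ (.one ⟨9, succReg 6, .const 0⟩) s with hs'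
  have e6 : s'.idx 6 = r := rfl
  have e8 : s'.mem 8 = s.mem 8 := run_mem_of_notMem _ _ (by simp [Prog.arrays])
  have e9 : ∀ k, s'.mem 9 r k = s.mem 9 r k := fun k => by
    simp [hs', run, State.put, IExp.eval, ← hr]
  have e90 : s'.mem 9 (r + 1) 0 = 1 := by simp [hs', run, State.put, IExp.eval, ← hr]
  have key := run_loop_mem (δ := δ) (fun i m => (∀ k, m 9 r k = s.mem 9 r k) ∧
    m 9 (r + 1) 0 = 1 ∧ ∀ k < i, m 9 (r + 1) (k + 1) = s.mem 9 r (k + 1) - s.mem 8 (k + 1) r -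
        ∑ j ∈ Finset.range k, s.mem 8 (j + 1) r * m 9 (r + 1) (k - j)) 7 (.reg 1)
    (.seq
      (.sub ⟨9, succReg 6, succReg 7⟩ ⟨9, .reg 6, succReg 7⟩ ⟨8, succReg 7, .reg 6⟩)
      (.loop 5 (.reg 7) (.seq
        (.mul (scalar 20) ⟨8, succReg 5, .reg 6⟩ ⟨9, succReg 6, .sub (.reg 7) (.reg 5)⟩)
        (.sub ⟨9, succReg 6, succReg 7⟩ ⟨9, succReg 6, succReg 7⟩ (scalar 20))))) s'
    ⟨e9, e90, by simp⟩ (by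
      rintro i hi t ht rfl ⟨h1, h2, h3⟩
      have t6 : t.idx 6 = r := ht.idx 6 (by simp [Prog.regs])
      have t8 : t.mem 8 = s.mem 8 := (ht.mem 8 (by simp [Prog.arrays])).trans e8
      set u := run δ (.sub ⟨9, succReg 6, succReg 7⟩ ⟨9, .reg 6, succReg 7⟩
        ⟨8, succReg 7, .reg 6⟩) t with hu
      have u9 : ∀ a b, u.mem 9 a b = if a = r + 1 ∧ b = t.idx 7 + 1 then
          s.mem 9 r (t.idx 7 + 1) - s.mem 8 (t.idx 7 + 1) r else t.mem 9 a b := fun a b => by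
        simp [hu, run, State.put, State.get, State.countOp, IExp.eval, t6, t8, h1]
      have u7 : u.idx 7 = t.idx 7 := rfl
      have u6 : u.idx 6 = r := t6
      have u8 : u.mem 8 = s.mem 8 := (run_mem_of_notMem _ _ (by simp [Prog.arrays])).trans t8
      have g := run_loop_sum (δ := δ) 9 (r + 1) (t.idx 7 + 1)
        (fun j => -(s.mem 8 (j + 1) r * t.mem 9 (r + 1) (t.idx 7 - j))) 5 (.reg 7)
        (.seq (.mul (scalar 20) ⟨8, succReg 5, .reg 6⟩ ⟨9, succReg 6, .sub (.reg 7) (.reg 5)⟩)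
          (.sub ⟨9, succReg 6, succReg 7⟩ ⟨9, succReg 6, succReg 7⟩ (scalar 20))) u
        (fun v hv hv9 _ a' b' => by
          have v6 : v.idx 6 = r := (hv.idx 6 (by simp [Prog.regs])).trans u6
          have v7 : v.idx 7 = t.idx 7 := hv.idx 7 (by simp [Prog.regs])
          have v8 : v.mem 8 = s.mem 8 := (hv.mem 8 (by simp [Prog.arrays])).trans u8
          -- The inner loop changes only column `t.idx 7 + 1`, so the earlier coefficients that it
          -- reads are final.
          have v9 : v.mem 9 (r + 1) (t.idx 7 - v.idx 5) = t.mem 9 (r + 1) (t.idx 7 - v.idx 5) := by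
            rw [hv9 _ _ (by omega), u9, if_neg (by omega)]
          simp [run, State.put, State.get, State.countOp, IExp.eval, v6, v7, v8, v9,
            sub_eq_add_neg])
      simp only [IExp.eval, u7] at g
      rw [run_seq, ← hu]
      have w9 : ∀ a b, ¬ (a = r + 1 ∧ b = t.idx 7 + 1) → (run δ (.loop 5 (.reg 7) (.seq
          (.mul (scalar 20) ⟨8, succReg 5, .reg 6⟩ ⟨9, succReg 6, .sub (.reg 7) (.reg 5)⟩)
          (.sub ⟨9, succReg 6, succReg 7⟩ ⟨9, succReg 6, succReg 7⟩ (scalar 20)))) u).mem 9 a b =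
          t.mem 9 a b := fun a b hab => by rw [g, if_neg hab, u9, if_neg hab]
      refine ⟨fun k => ?_, ?_, fun k hk => ?_⟩
      · rw [← h1 k]; exact w9 _ _ (by omega)
      · rw [← h2]; exact w9 _ _ (by omega)
      · have hsum : ∀ j ∈ Finset.range k, _ = t.mem 9 (r + 1) (k - j) :=
          fun j hj => w9 (r + 1) (k - j) (by omega)
        rw [Finset.sum_congr rfl fun j hj => congrArg _ (hsum j hj)]
        rcases Nat.lt_succ_iff_lt_or_eq.mp hk with hk | rfl
        · rw [← h3 k hk]; exact w9 _ _ (by omega)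
        · have := g (r + 1) (t.idx 7 + 1)
          rw [if_pos ⟨rfl, rfl⟩, u9, if_pos ⟨rfl, rfl⟩, Finset.sum_neg_distrib, ← sub_eq_add_neg]
            at this
          exact this)
  exact key.2

end

/-- The matrix in the upper left corner of an array. -/
def toMat {R : Type*} (q p : ℕ) (m : ℕ → ℕ → R) : Matrix (Fin q) (Fin p) R := Matrix.of fun i j => m i j

theorem toMat_apply {R : Type*} {q p : ℕ} (m : ℕ → ℕ → R) (i : Fin q) (j : Fin p) :
    toMat q p m i j = m i j := rfl

section

variable {R : Type*} [CommRing R] {δ : R → R → Option R}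

theorem toMat_ofMatrix {q p : ℕ} (A : Matrix (Fin q) (Fin p) R) : toMat q p (ofMatrix A) = A := by
  ext i j
  simp [toMat, ofMatrix]

theorem toMat_matMul {d x y m n l : ℕ} {s : State R} {m' n' l' : ℕ} (hm' : s.idx m = m')
    (hn' : s.idx n = n') (hl' : s.idx l = l') (hd : d ≠ 20) (hx : x ∉ [d, 20])
    (hy : y ∉ [d, 20]) (hn : n ∉ [3, 4, 5]) (hl : l ∉ [3, 4, 5]) :
    toMat m' n' ((run δ (matMul d x y m n l) s).mem d) =
      toMat m' l' (s.mem x) * toMat l' n' (s.mem y) := by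
  ext i j
  rw [toMat_apply, run_matMul d x y m n l s hd hx hy hn hl,
    if_pos ⟨by rw [hm']; exact i.2, by rw [hn']; exact j.2⟩, hl', Matrix.mul_apply,
    ← Fin.sum_univ_eq_sum_range (fun k => s.mem x i k * s.mem y k j)]
  rfl

/-- Before round `r`, array `7` holds the truncation of `T` to `r` rows and row `r` of array `9` its
reversed characteristic polynomial. The zero arrays at the start, with one entry set to `1`, are the
case `r = 0`. -/
theorem run_charpolyProg {q : ℕ} {s : State R} (hq : s.idx 1 = q)
    (h7 : ∀ a b, s.mem 7 a b = 0) (h9 : ∀ a b, s.mem 9 a b = 0) : ∀ k ≤ q,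
    (run δ charpolyProg s).mem 9 q k = (toMat q q (s.mem 6)).charpolyRev.coeff k := by
  set T := toMat q q (s.mem 6) with hT
  set s' := run δ (.one (scalar 9)) s with hs'
  have e6 : s'.mem 6 = s.mem 6 := run_mem_of_notMem _ _ (by simp [Prog.arrays])
  have e7 : s'.mem 7 = s.mem 7 := run_mem_of_notMem _ _ (by simp [Prog.arrays])
  have e1 : (IExp.reg 1).eval s'.idx = q := hq
  have key := run_loop_mem (δ := δ) (fun r m => (∀ i j : Fin q, m 7 i j = rowTrunc T r i j) ∧
    ∀ k ≤ q, m 9 r k = (rowTrunc T r).charpolyRev.coeff k) 6 (.reg 1)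
    (.seq copyRow (.seq unitVector (.seq krylov divideSeries))) s' ?_ ?_
  · rw [e1, rowTrunc_self] at key
    exact key.2
  · refine ⟨fun i j => ?_, fun k _ => ?_⟩
    · rw [e7, h7, rowTrunc_zero]; rfl
    · rw [rowTrunc_zero]
      simp [hs', run, State.put, IExp.eval, h9, Matrix.charpolyRev, Polynomial.coeff_one]
  · rintro r hr t ht rfl ⟨h7, h9⟩
    rw [e1] at hr
    have t1 : t.idx 1 = q := by
      rw [← hq]
      exact ht.idx 1 (by simp [Prog.regs, copyRow, unitVector, krylov, divideSeries])
    have t6 : t.mem 6 = s.mem 6 := (ht.mem 6 (by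
      simp [Prog.arrays, copyRow, unitVector, krylov, divideSeries])).trans e6
    rw [run_seq, run_seq, run_seq]
    set u₁ := run δ copyRow t with hu₁
    set u₂ := run δ unitVector u₁ with hu₂
    set u₃ := run δ krylov u₂ with hu₃
    set u₄ := run δ divideSeries u₃ with hu₄
    have i1 : u₁.idx 1 = q ∧ u₁.idx 6 = t.idx 6 :=
      ⟨(run_idx_of_notMem _ _ (by simp [Prog.regs, copyRow])).trans t1,
        run_idx_of_notMem _ _ (by simp [Prog.regs, copyRow])⟩
    have i2 : u₂.idx 1 = q ∧ u₂.idx 6 = t.idx 6 :=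
      ⟨(run_idx_of_notMem _ _ (by simp [Prog.regs, unitVector])).trans i1.1,
        (run_idx_of_notMem _ _ (by simp [Prog.regs, unitVector])).trans i1.2⟩
    have i3 : u₃.idx 1 = q ∧ u₃.idx 6 = t.idx 6 :=
      ⟨(run_idx_of_notMem _ _ (by simp [Prog.regs, krylov])).trans i2.1,
        (run_idx_of_notMem _ _ (by simp [Prog.regs, krylov])).trans i2.2⟩
    have m7 : ∀ i j : Fin q, u₁.mem 7 i j = rowTrunc T (t.idx 6 + 1) i j := by
      intro i j
      rw [hu₁, run_copyRow, t6, h7, t1]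
      simp only [rowTrunc, Matrix.of_apply, j.2, and_true]
      split_ifs with h1 h2 h2 h2 <;> first | rfl | omega
    have u27 : u₂.mem 7 = u₁.mem 7 := run_mem_of_notMem _ _ (by simp [Prog.arrays, unitVector])
    have u47 : u₄.mem 7 = u₁.mem 7 := by
      rw [hu₄, run_mem_of_notMem _ _ (by simp [Prog.arrays, divideSeries]), hu₃,
        run_mem_of_notMem _ _ (by simp [Prog.arrays, krylov]), u27]
    have u39 : u₃.mem 9 = t.mem 9 := by
      rw [hu₃, run_mem_of_notMem _ _ (by simp [Prog.arrays, krylov]), hu₂,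
        run_mem_of_notMem _ _ (by simp [Prog.arrays, unitVector]), hu₁,
        run_mem_of_notMem _ _ (by simp [Prog.arrays, copyRow])]
    have hk := run_krylov (δ := δ) u₂
    have hd := run_divideSeries (δ := δ) u₃
    rw [i2.1, ← hu₃] at hk
    rw [i3.1, i3.2, ← hu₄, u39] at hd
    refine ⟨fun i j => by rw [u47, m7], ?_⟩
    refine coeff_charpolyRev_rowTrunc_succ_of_recursion T ⟨t.idx 6, hr⟩ (u₃.mem 8)
      (t.mem 9 (t.idx 6)) _ (fun i hi => ?_) (fun k hk' i => ?_) h9 hd.1 hd.2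
    · rw [hk.1, hu₂, run_unitVector _ _ (by rw [i1.1]; exact hi), i1.2]
    · rw [hk.2 k hk' i i.2, ← Fin.sum_univ_eq_sum_range (fun j => u₂.mem 7 i j * u₃.mem 8 k j), u27]
      exact Finset.sum_congr rfl fun j _ => by rw [m7]

theorem run_idempotentStep (hδ : IsDivTest δ) (s : State R) :
    (∀ a b, ¬ (a = s.idx 6 + 1 ∧ b = 0) →
      (run δ idempotentStep s).mem 10 a b = s.mem 10 a b) ∧
    (∀ a ∈ [11, 12, 13], ∀ b c, ¬ (b = s.idx 6 ∧ c = 0) →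
      (run δ idempotentStep s).mem a b c = s.mem a b c) ∧
    ∃ x z, x = s.mem 10 (s.idx 6) 0 * s.mem 9 (s.idx 1) (s.idx 1 - s.idx 6) ∧
      (x ∈ Ideal.span {x * x} → x = z * (x * x)) ∧
      (run δ idempotentStep s).mem 11 (s.idx 6) 0 = x ∧
      (run δ idempotentStep s).mem 12 (s.idx 6) 0 = z ∧
      (run δ idempotentStep s).mem 13 (s.idx 6) 0 = z * x * z ∧
      (run δ idempotentStep s).mem 10 (s.idx 6 + 1) 0 =
        s.mem 10 (s.idx 6) 0 - z * x * s.mem 10 (s.idx 6) 0 := by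
  set x := s.mem 10 (s.idx 6) 0 * s.mem 9 (s.idx 1) (s.idx 1 - s.idx 6) with hx
  have h := hδ x (x * x)
  rcases hz : δ x (x * x) with _ | z
  -- After a negative answer `z` is the old content of the cell; nothing is claimed about it unless
  -- `x ∈ ⟨x ^ 2⟩`.
  · refine ⟨?_, ?_, x, s.mem 12 (s.idx 6) 0, rfl, ?_, ?_⟩
    · intro a b hab
      simp [idempotentStep, run, State.put, State.get, State.countOp, State.countTest, IExp.eval,
        ← hx, hz, hab]
    · intro a ha b c hbc
      simp only [List.mem_cons, List.not_mem_nil, or_false] at ha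
      rcases ha with rfl | rfl | rfl <;>
      simp [idempotentStep, run, State.put, State.get, State.countOp, State.countTest, IExp.eval,
        ← hx, hz, hbc]
    · intro hm
      obtain ⟨z, h1, -⟩ := h.1 hm
      simp [hz] at h1
    · simp [idempotentStep, run, State.put, State.get, State.countOp, State.countTest, IExp.eval,
        ← hx, hz]
  · refine ⟨?_, ?_, x, z, rfl, ?_, ?_⟩
    · intro a b hab
      simp [idempotentStep, run, State.put, State.get, State.countOp, State.countTest, IExp.eval,
        ← hx, hz, hab]
    · intro a ha b c hbc
      simp only [List.mem_cons, List.not_mem_nil, or_false] at ha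
      rcases ha with rfl | rfl | rfl <;>
      simp [idempotentStep, run, State.put, State.get, State.countOp, State.countTest, IExp.eval,
        ← hx, hz, hbc]
    · intro hm
      obtain ⟨z', h1, h2⟩ := h.1 hm
      rw [hz, Option.some_inj] at h1
      rw [h1]; exact h2
    · simp [idempotentStep, run, State.put, State.get, State.countOp, State.countTest, IExp.eval,
        ← hx, hz]

theorem run_idempotentProg (hδ : IsDivTest δ) {q : ℕ} {s : State R} (hq : s.idx 1 = q)
    {m : ℕ → ℕ → ℕ → R} (hm : m = (run δ idempotentProg s).mem) :
    m 10 0 0 = 1 ∧ ∀ i < q, m 11 i 0 = m 10 i 0 * s.mem 9 q (q - i) ∧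
      (m 11 i 0 ∈ Ideal.span {m 11 i 0 * m 11 i 0} →
        m 11 i 0 = m 12 i 0 * (m 11 i 0 * m 11 i 0)) ∧
      m 13 i 0 = m 12 i 0 * m 11 i 0 * m 12 i 0 ∧
      m 10 (i + 1) 0 = m 10 i 0 - m 12 i 0 * m 11 i 0 * m 10 i 0 := by
  subst hm
  set s' := run δ (.one (scalar 10)) s with hs'
  have e1 : s'.idx 1 = q := hq
  have e9 : s'.mem 9 = s.mem 9 := run_mem_of_notMem _ _ (by simp [Prog.arrays])
  have key := run_loop_mem (δ := δ) (fun n m => m 10 0 0 = 1 ∧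
    ∀ i < n, m 11 i 0 = m 10 i 0 * s.mem 9 q (q - i) ∧
      (m 11 i 0 ∈ Ideal.span {m 11 i 0 * m 11 i 0} →
        m 11 i 0 = m 12 i 0 * (m 11 i 0 * m 11 i 0)) ∧
      m 13 i 0 = m 12 i 0 * m 11 i 0 * m 12 i 0 ∧
      m 10 (i + 1) 0 = m 10 i 0 - m 12 i 0 * m 11 i 0 * m 10 i 0) 6 (.reg 1)
    idempotentStep s' ?_ ?_
  · rwa [IExp.eval, e1] at key
  · simp [hs', run, State.put, IExp.eval]
  · rintro i hi t ht rfl ⟨h0, hI⟩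
    have t1 : t.idx 1 = q := (ht.idx 1 (by simp [Prog.regs, idempotentStep])).trans e1
    have t9 : t.mem 9 = s.mem 9 := (ht.mem 9 (by simp [Prog.arrays, idempotentStep])).trans e9
    obtain ⟨g1, g2, x, z, hx, hz, k1, k2, k3, k4⟩ := run_idempotentStep hδ t
    refine ⟨by rw [g1 _ _ (by omega), h0], fun i hi' => ?_⟩
    rcases Nat.lt_succ_iff_lt_or_eq.mp hi' with hi' | rfl
    · rw [g1 i 0 (by omega), g1 (i + 1) 0 (by omega), g2 11 (by simp) i 0 (by omega),
        g2 12 (by simp) i 0 (by omega), g2 13 (by simp) i 0 (by omega)]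
      exact hI i hi'
    · rw [k1, k2, k3, k4, g1 _ _ (by omega)]
      refine ⟨by rw [hx, t1, t9], hz, rfl, rfl⟩

theorem toMat_hornerStep {q : ℕ} {s : State R} (hq : s.idx 1 = q) :
    toMat q q ((run δ hornerStep s).mem 15) =
      toMat q q (s.mem 6) * toMat q q (s.mem 15) + s.mem 9 q (s.idx 6) • 1 := by
  rw [hornerStep, run_seq, run_seq]
  have h1 := toMat_matMul (δ := δ) (d := 14) (x := 6) (y := 15) hq hq hq (by simp) (by simp)
    (by simp) (by simp) (by simp)
  rw [← h1]
  set u := run δ (matMul 14 6 15 1 1 1) s with hu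
  have u1 : u.idx 1 = q := (run_idx_of_notMem _ _ (by simp [Prog.regs, matMul, forEntries])).trans hq
  have u6 : u.idx 6 = s.idx 6 := run_idx_of_notMem _ _ (by simp [Prog.regs, matMul, forEntries])
  have u9 : u.mem 9 = s.mem 9 := run_mem_of_notMem _ _ (by simp [Prog.arrays, matMul, forEntries])
  have h2 := run_forEntries (δ := δ) 15 1 1 (.copy (entry 15 3 4) (entry 14 3 4))
    (fun a b _ => u.mem 14 a b) u (by simp [Prog.regs]) (by simp [Prog.regs]) (fun t ht a b => by
      have t14 := ht.mem 14 (by simp [Prog.arrays])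
      by_cases h : a = t.idx 3 ∧ b = t.idx 4
      · simp [run, State.put, State.get, IExp.eval, h.1, h.2, t14]
      · simp [run, State.put, IExp.eval, h])
  set v := run δ (forEntries 1 1 (.copy (entry 15 3 4) (entry 14 3 4))) u with hv
  have v1 : v.idx 1 = q := (run_idx_of_notMem _ _ (by simp [Prog.regs, forEntries])).trans u1
  have v6 : v.idx 6 = s.idx 6 := (run_idx_of_notMem _ _ (by simp [Prog.regs, forEntries])).trans u6
  have v9 : v.mem 9 = s.mem 9 :=
    (run_mem_of_notMem _ _ (by simp [Prog.arrays, forEntries])).trans u9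
  have h3 := fun a b => run_loop_update (δ := δ) 15 (fun a b => a = b) (fun a _ => a)
    (fun _ _ x => x + s.mem 9 q (s.idx 6)) 3 (.reg 1)
    (.add (entry 15 3 3) (entry 15 3 3) (entry 9 1 6)) v (fun t ht _ _ a b => by
      have t1 := (ht.idx 1 (by simp [Prog.regs])).trans v1
      have t6 := (ht.idx 6 (by simp [Prog.regs])).trans v6
      have t9 := (ht.mem 9 (by simp [Prog.arrays])).trans v9
      constructor
      · rintro rfl rfl
        simp [run, State.put, State.get, State.countOp, IExp.eval, t1, t6, t9]
      · intro h
        have h' : ¬ (a = t.idx 3 ∧ b = t.idx 3) := by omega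
        simp [run, State.put, State.countOp, IExp.eval, h']) a b
  simp only [IExp.eval, v1] at h3
  rw [u1] at h2
  ext i j
  rw [toMat_apply, Matrix.add_apply, Matrix.smul_apply, toMat_apply]
  by_cases hij : i = j
  · subst hij
    rw [(h3 i i).1 rfl i.2, h2, if_pos ⟨i.2, i.2⟩]
    simp
  · rw [(h3 i j).2 (by simpa [Fin.ext_iff] using fun h => absurd (Fin.ext h) hij), h2,
      if_pos ⟨i.2, j.2⟩]
    simp [hij]

theorem toMat_accumulateStep {q : ℕ} {s : State R} (hq : s.idx 1 = q) :
    toMat q q ((run δ accumulateStep s).mem 16) =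
      toMat q q (s.mem 16) + (-s.mem 13 (q - (s.idx 6 + 1)) 0) • toMat q q (s.mem 15) := by
  have h := run_forEntries (δ := δ) 16 1 1 (.seq
      (.mul (scalar 20) ⟨13, .sub (.reg 1) (succReg 6), .const 0⟩ (entry 15 3 4))
      (.sub (entry 16 3 4) (entry 16 3 4) (scalar 20)))
    (fun a b x => x - s.mem 13 (q - (s.idx 6 + 1)) 0 * s.mem 15 a b) s (by simp [Prog.regs])
    (by simp [Prog.regs]) (fun t ht a b => by
      have t1 := (ht.idx 1 (by simp [Prog.regs])).trans hq
      have t6 := ht.idx 6 (by simp [Prog.regs])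
      have t13 := ht.mem 13 (by simp [Prog.arrays])
      have t15 := ht.mem 15 (by simp [Prog.arrays])
      by_cases h : a = t.idx 3 ∧ b = t.idx 4
      · simp [run, State.put, State.get, State.countOp, IExp.eval, h.1, h.2, t1, t6, t13, t15]
      · simp [run, State.put, State.countOp, IExp.eval, h])
  ext i j
  rw [toMat_apply, accumulateStep, h, hq, if_pos ⟨i.2, j.2⟩, Matrix.add_apply, Matrix.smul_apply,
    toMat_apply, toMat_apply, smul_eq_mul]
  ring

theorem toMat_groupInverseProg {q : ℕ} {s : State R} (hq : s.idx 1 = q)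
    (h15 : ∀ a b, s.mem 15 a b = 0) (h16 : ∀ a b, s.mem 16 a b = 0) :
    toMat q q ((run δ groupInverseProg s).mem 16) = ∑ i ∈ Finset.range q,
      (-s.mem 13 i 0) • horner (toMat q q (s.mem 6)) (s.mem 9 q) (q - i) := by
  have key := run_loop_mem (δ := δ) (fun k m =>
    toMat q q (m 15) = horner (toMat q q (s.mem 6)) (s.mem 9 q) k ∧
    toMat q q (m 16) = ∑ i ∈ Finset.range k, (-s.mem 13 (q - (i + 1)) 0) •
      horner (toMat q q (s.mem 6)) (s.mem 9 q) (i + 1)) 6 (.reg 1)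
    (.seq hornerStep accumulateStep) s ?_ ?_
  · rw [IExp.eval, hq] at key
    -- The program meets the Horner matrices by increasing index, while the idempotents were found
    -- by decreasing rank.
    rw [groupInverseProg, key.2, ← Finset.sum_range_reflect]
    refine Finset.sum_congr rfl fun i hi => ?_
    have := Finset.mem_range.mp hi
    rw [show q - (q - 1 - i + 1) = i by omega, show q - 1 - i + 1 = q - i by omega]
  · refine ⟨?_, ?_⟩ <;> ext i j
    · rw [toMat_apply, h15]; rfl
    · rw [toMat_apply, h16]; simp
  · rintro k hk t ht rfl ⟨h1, h2⟩
    have t1 := (ht.idx 1 (by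
      simp [Prog.regs, hornerStep, accumulateStep, matMul, forEntries])).trans hq
    have t6 := ht.mem 6 (by simp [Prog.arrays, hornerStep, accumulateStep, matMul, forEntries])
    have t9 := ht.mem 9 (by simp [Prog.arrays, hornerStep, accumulateStep, matMul, forEntries])
    have t13 := ht.mem 13 (by simp [Prog.arrays, hornerStep, accumulateStep, matMul, forEntries])
    have e15 := toMat_hornerStep (δ := δ) t1
    rw [t6, t9, h1] at e15
    rw [run_seq]
    set u := run δ hornerStep t with hu
    have u1 : u.idx 1 = q :=
      (run_idx_of_notMem _ _ (by simp [Prog.regs, hornerStep, matMul, forEntries])).trans t1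
    have u6 : u.idx 6 = t.idx 6 :=
      run_idx_of_notMem _ _ (by simp [Prog.regs, hornerStep, matMul, forEntries])
    have u13 : u.mem 13 = s.mem 13 := (run_mem_of_notMem _ _ (by
      simp [Prog.arrays, hornerStep, matMul, forEntries])).trans t13
    have u16 : u.mem 16 = t.mem 16 :=
      run_mem_of_notMem _ _ (by simp [Prog.arrays, hornerStep, matMul, forEntries])
    refine ⟨?_, ?_⟩
    · rw [run_mem_of_notMem _ _ (by simp [Prog.arrays, accumulateStep, forEntries]), e15]
      rfl
    · rw [toMat_accumulateStep u1, u16, h2, u13, u6, e15, Finset.sum_range_succ]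
      rfl

end

theorem toMat_eq_iff {R : Type*} {q p : ℕ} {m m' : ℕ → ℕ → R} :
    toMat q p m = toMat q p m' ↔ ∀ a < q, ∀ b < p, m a b = m' a b := by
  rw [← Matrix.ext_iff]
  exact ⟨fun h a ha b hb => h ⟨a, ha⟩ ⟨b, hb⟩, fun h i j => h i i.2 j j.2⟩

/-! ### Verification, and the two complete programs -/

section

variable {R : Type*} [CommRing R] {δ : R → R → Option R}

open Classical in
theorem run_verifyProg (hδ : IsDivTest δ) {p q : ℕ} {s : State R} (hp : s.idx 0 = p)
    (hq : s.idx 1 = q) (h0 : s.mem 21 0 0 = 0) {T S : Matrix (Fin q) (Fin q) R}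
    {M : Matrix (Fin q) (Fin p) R} {M' : Matrix (Fin p) (Fin q) R} (hM : toMat q p (s.mem 2) = M)
    (hM' : toMat p q (s.mem 3) = M') (hT : toMat q q (s.mem 6) = T)
    (hS : toMat q q (s.mem 16) = S) :
    (run δ verifyProg s).idx 2 = if T * S * M = M ∧ M' * (T * S) = M' then 1 else 0 := by
  rw [verifyProg, run_seq, run_seq, run_seq, run_seq, run_seq]
  set u₁ := run δ (matMul 17 6 16 1 1 1) s with hu₁
  have i₁ : ∀ k < 2, u₁.idx k = s.idx k := fun k hk =>
    run_idx_of_notMem _ _ (by simp [Prog.regs, matMul, forEntries]; omega)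
  have f₁ : ∀ a, a ∉ [17, 20] → u₁.mem a = s.mem a := fun a ha =>
    run_mem_of_notMem _ _ (by
      simp only [List.mem_cons, List.not_mem_nil, or_false, not_or] at ha
      simp [Prog.arrays, matMul, forEntries, ha])
  have g₁ : toMat q q (u₁.mem 17) = T * S := by
    rw [← hT, ← hS]
    exact toMat_matMul hq hq hq (by simp) (by simp) (by simp) (by simp) (by simp)
  set u₂ := run δ (matMul 18 17 2 1 0 1) u₁ with hu₂
  have i₂ : ∀ k < 2, u₂.idx k = s.idx k := fun k hk =>
    (run_idx_of_notMem _ _ (by simp [Prog.regs, matMul, forEntries]; omega)).trans (i₁ k hk)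
  have f₂ : ∀ a, a ∉ [18, 20] → u₂.mem a = u₁.mem a := fun a ha =>
    run_mem_of_notMem _ _ (by
      simp only [List.mem_cons, List.not_mem_nil, or_false, not_or] at ha
      simp [Prog.arrays, matMul, forEntries, ha])
  have g₂ : toMat q p (u₂.mem 18) = T * S * M := by
    rw [← g₁, ← hM, ← f₁ 2 (by simp)]
    exact toMat_matMul ((i₁ 1 (by simp)).trans hq) ((i₁ 0 (by simp)).trans hp)
      ((i₁ 1 (by simp)).trans hq) (by simp) (by simp) (by simp) (by simp) (by simp)
  set u₃ := run δ (matMul 19 3 17 0 1 1) u₂ with hu₃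
  have i₃ : ∀ k < 2, u₃.idx k = s.idx k := fun k hk =>
    (run_idx_of_notMem _ _ (by simp [Prog.regs, matMul, forEntries]; omega)).trans (i₂ k hk)
  have f₃ : ∀ a, a ∉ [19, 20] → u₃.mem a = u₂.mem a := fun a ha =>
    run_mem_of_notMem _ _ (by
      simp only [List.mem_cons, List.not_mem_nil, or_false, not_or] at ha
      simp [Prog.arrays, matMul, forEntries, ha])
  have g₃ : toMat p q (u₃.mem 19) = M' * (T * S) := by
    rw [← g₁, ← hM', ← f₁ 3 (by simp), ← f₂ 3 (by simp), ← f₂ 17 (by simp)]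
    exact toMat_matMul ((i₂ 0 (by simp)).trans hp) ((i₂ 1 (by simp)).trans hq)
      ((i₂ 1 (by simp)).trans hq) (by simp) (by simp) (by simp) (by simp) (by simp)
  set u₄ := run δ (.setIdx 2 (.const 1)) u₃ with hu₄
  have i₄ : u₄.idx 0 = p ∧ u₄.idx 1 = q ∧ u₄.idx 2 = 1 :=
    ⟨(i₃ 0 (by simp)).trans hp, (i₃ 1 (by simp)).trans hq, rfl⟩
  have f₄ : u₄.mem = u₃.mem := rfl
  have n₄ : u₄.mem 21 0 0 = 0 := by
    rw [f₄, f₃ 21 (by simp), f₂ 21 (by simp), f₁ 21 (by simp), h0]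
  have c₅ := run_checkEq hδ 18 2 1 0 u₄ n₄ (by simp) (by simp) (by simp)
  rw [i₄.1, i₄.2.1, i₄.2.2, f₄, f₃ 18 (by simp), f₃ 2 (by simp)] at c₅
  simp only [← toMat_eq_iff] at c₅
  rw [g₂, f₂ 2 (by simp), f₁ 2 (by simp), hM] at c₅
  set u₅ := run δ (checkEq 18 2 1 0) u₄ with hu₅
  have i₅ : ∀ k < 2, u₅.idx k = u₄.idx k := fun k hk =>
    run_idx_of_notMem _ _ (by simp [Prog.regs, checkEq, forEntries]; omega)
  have f₅ : ∀ a ≠ 20, u₅.mem a = u₃.mem a := fun a ha =>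
    run_mem_of_notMem _ _ (by simpa [Prog.arrays, checkEq, forEntries] using ha)
  have c₆ := run_checkEq hδ 19 3 0 1 u₅ (by rw [f₅ 21 (by simp), ← f₄, n₄]) (by simp) (by simp)
    (by simp)
  rw [c₅, i₅ 0 (by simp), i₅ 1 (by simp), i₄.1, i₄.2.1, f₅ 19 (by simp),
    f₅ 3 (by simp)] at c₆
  simp only [← toMat_eq_iff] at c₆
  rw [g₃, f₃ 3 (by simp), f₂ 3 (by simp), f₁ 3 (by simp), hM'] at c₆
  rw [c₆, ite_and]
  split_ifs <;> rfl

-- `Z` commutes with `M * M'` for every input, as a polynomial in it; only the identity `T ^ 2 Z =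
-- T` depends on the existence of a group inverse.
open Classical in
theorem run_crossedProg (hδ : IsDivTest δ) {p q : ℕ} {PE : Matrix (Fin p) (Fin p) R}
    {PF : Matrix (Fin q) (Fin q) R} {M : Matrix (Fin q) (Fin p) R} {M' : Matrix (Fin p) (Fin q) R}
    {s : State R} (hs : s = run δ crossedProg (input PE PF M M')) :
    s.idx 0 = p ∧ s.idx 1 = q ∧ toMat q p (s.mem 2) = M ∧ toMat p q (s.mem 3) = M' ∧
      ∃ Z : Matrix (Fin q) (Fin q) R, toMat q q (s.mem 16) = Z ∧ Commute (M * M') Z ∧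
        (∀ S, IsGroupInverse (M * M') S → M * M' * (M * M' * Z) = M * M') ∧
        s.idx 2 = if M * M' * Z * M = M ∧ M' * (M * M' * Z) = M' then 1 else 0 := by
  rw [hs]
  set s₀ := input PE PF M M' with hs₀
  have h0 : ∀ a, 3 < a → s₀.mem a = fun _ _ => 0 := by
    rintro (_ | _ | _ | _ | a) ha
    all_goals first | omega | rfl
  have h2 : toMat q p (s₀.mem 2) = M := toMat_ofMatrix M
  have h3 : toMat p q (s₀.mem 3) = M' := toMat_ofMatrix M'
  rw [crossedProg, run_seq, run_seq, run_seq, run_seq]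
  set u₁ := run δ (matMul 6 2 3 1 1 0) s₀ with hu₁
  have i₁ : ∀ k < 2, u₁.idx k = s₀.idx k := fun k hk =>
    run_idx_of_notMem _ _ (by simp [Prog.regs, matMul, forEntries]; omega)
  have f₁ : ∀ a, a ∉ [6, 20] → u₁.mem a = s₀.mem a := fun a ha =>
    run_mem_of_notMem _ _ (by
      simp only [List.mem_cons, List.not_mem_nil, or_false, not_or] at ha
      simp [Prog.arrays, matMul, forEntries, ha])
  have g₁ : toMat q q (u₁.mem 6) = M * M' := by
    rw [← h2, ← h3]
    exact toMat_matMul rfl rfl rfl (by simp) (by simp) (by simp) (by simp) (by simp)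
  set u₂ := run δ charpolyProg u₁ with hu₂
  have i₂ : ∀ k < 2, u₂.idx k = s₀.idx k := fun k hk => (run_idx_of_notMem _ _ (by
    simp [Prog.regs, charpolyProg, copyRow, unitVector, krylov, divideSeries]; omega)).trans
      (i₁ k hk)
  have f₂ : ∀ a, a ∉ [7, 8, 9, 20] → u₂.mem a = u₁.mem a := fun a ha => run_mem_of_notMem _ _ (by
    simp only [List.mem_cons, List.not_mem_nil, or_false, not_or] at ha
    simp [Prog.arrays, charpolyProg, copyRow, unitVector, krylov, divideSeries, ha])
  have g₂ := run_charpolyProg (δ := δ) (q := q) (s := u₁) (i₁ 1 (by simp))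
    (fun a b => by rw [f₁ 7 (by simp), h0 7 (by simp)])
    (fun a b => by rw [f₁ 9 (by simp), h0 9 (by simp)])
  rw [← hu₂, g₁] at g₂
  set u₃ := run δ idempotentProg u₂ with hu₃
  have i₃ : ∀ k < 2, u₃.idx k = s₀.idx k := fun k hk => (run_idx_of_notMem _ _ (by
    simp [Prog.regs, idempotentProg, idempotentStep]; omega)).trans (i₂ k hk)
  have f₃ : ∀ a, a ∉ [10, 11, 12, 13, 20, 22] → u₃.mem a = u₂.mem a := fun a ha =>
    run_mem_of_notMem _ _ (by
      simp only [List.mem_cons, List.not_mem_nil, or_false, not_or] at ha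
      simp [Prog.arrays, idempotentProg, idempotentStep, ha])
  have g₃ := run_idempotentProg hδ (q := q) (s := u₂) (i₂ 1 (by simp)) rfl
  rw [← hu₃] at g₃
  set u₄ := run δ groupInverseProg u₃ with hu₄
  have i₄ : ∀ k < 2, u₄.idx k = s₀.idx k := fun k hk => (run_idx_of_notMem _ _ (by
    simp [Prog.regs, groupInverseProg, hornerStep, accumulateStep, matMul, forEntries]
    omega)).trans (i₃ k hk)
  have f₄ : ∀ a, a ∉ [14, 15, 16, 20] → u₄.mem a = u₃.mem a := fun a ha => run_mem_of_notMem _ _ (by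
    simp only [List.mem_cons, List.not_mem_nil, or_false, not_or] at ha
    simp [Prog.arrays, groupInverseProg, hornerStep, accumulateStep, matMul, forEntries, ha])
  have g₄ := toMat_groupInverseProg (δ := δ) (q := q) (s := u₃) (i₃ 1 (by simp))
    (fun a b => by rw [f₃ 15 (by simp), f₂ 15 (by simp), f₁ 15 (by simp), h0 15 (by simp)])
    (fun a b => by rw [f₃ 16 (by simp), f₂ 16 (by simp), f₁ 16 (by simp), h0 16 (by simp)])
  rw [← hu₄, f₃ 6 (by simp), f₂ 6 (by simp), g₁, f₃ 9 (by simp)] at g₄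
  have k2 : toMat q p (u₄.mem 2) = M := by
    rw [f₄ 2 (by simp), f₃ 2 (by simp), f₂ 2 (by simp), f₁ 2 (by simp), h2]
  have k3 : toMat p q (u₄.mem 3) = M' := by
    rw [f₄ 3 (by simp), f₃ 3 (by simp), f₂ 3 (by simp), f₁ 3 (by simp), h3]
  have k6 : toMat q q (u₄.mem 6) = M * M' := by
    rw [f₄ 6 (by simp), f₃ 6 (by simp), f₂ 6 (by simp), g₁]
  have k21 : u₄.mem 21 0 0 = 0 := by
    rw [f₄ 21 (by simp), f₃ 21 (by simp), f₂ 21 (by simp), f₁ 21 (by simp), h0 21 (by simp)]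
  have f₅ : ∀ a, a ∉ [17, 18, 19, 20] → (run δ verifyProg u₄).mem a = u₄.mem a := fun a ha =>
    run_mem_of_notMem _ _ (by
      simp only [List.mem_cons, List.not_mem_nil, or_false, not_or] at ha
      simp [Prog.arrays, verifyProg, checkEq, matMul, forEntries, ha])
  have i₅ : ∀ k < 2, (run δ verifyProg u₄).idx k = s₀.idx k := fun k hk =>
    (run_idx_of_notMem _ _ (by
      simp [Prog.regs, verifyProg, checkEq, matMul, forEntries]; omega)).trans (i₄ k hk)
  refine ⟨i₅ 0 (by simp), i₅ 1 (by simp), by rw [f₅ 2 (by simp), k2], by rw [f₅ 3 (by simp), k3],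
    toMat q q (u₄.mem 16), by rw [f₅ 16 (by simp)], ?_, ?_,
    run_verifyProg hδ (i₄ 0 (by simp)) (i₄ 1 (by simp)) k21 k2 k3 k6 rfl⟩
  · rw [g₄]
    exact Commute.sum_right _ _ _ fun i _ => (commute_horner _ _ _).smul_right _
  · intro S hS
    rw [g₄]
    exact hS.mul_mul_sum_horner (u₂.mem 9 q) (fun i => u₃.mem 10 i 0) (fun i => u₃.mem 11 i 0)
      (fun i => u₃.mem 12 i 0) (fun i => u₃.mem 13 i 0) g₂ g₃.1 (fun i hi => (g₃.2 i hi).1)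
      (fun i hi => (g₃.2 i hi).2.1) (fun i hi => (g₃.2 i hi).2.2.1)
      (fun i hi => (g₃.2 i hi).2.2.2)

theorem run_igProg {p q : ℕ} {s : State R} (hp : s.idx 0 = p) (hq : s.idx 1 = q) :
    toMat p q ((run δ igProg s).mem 4) = toMat p q (s.mem 3) * toMat q q (s.mem 16) ∧
      toMat q p ((run δ igProg s).mem 5) = toMat q q (s.mem 16) * toMat q p (s.mem 2) := by
  rw [igProg, run_seq]
  set u := run δ (matMul 4 3 16 0 1 1) s with hu
  have i : ∀ k < 2, u.idx k = s.idx k := fun k hk =>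
    run_idx_of_notMem _ _ (by simp [Prog.regs, matMul, forEntries]; omega)
  have f : ∀ a, a ∉ [4, 20] → u.mem a = s.mem a := fun a ha =>
    run_mem_of_notMem _ _ (by
      simp only [List.mem_cons, List.not_mem_nil, or_false, not_or] at ha
      simp [Prog.arrays, matMul, forEntries, ha])
  constructor
  · rw [run_mem_of_notMem _ _ (by simp [Prog.arrays, matMul, forEntries])]
    exact toMat_matMul hp hq hq (by simp) (by simp) (by simp) (by simp) (by simp)
  · rw [← f 16 (by simp), ← f 2 (by simp)]
    exact toMat_matMul ((i 1 (by simp)).trans hq) ((i 0 (by simp)).trans hp)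
      ((i 1 (by simp)).trans hq) (by simp) (by simp) (by simp) (by simp) (by simp)

end

/-! ### Cost bounds -/

theorem tame_crossedProg : crossedProg.Tame := by
  simp [crossedProg, charpolyProg, copyRow, unitVector, krylov, divideSeries, idempotentProg,
    idempotentStep, groupInverseProg, hornerStep, accumulateStep, verifyProg, matMul, checkEq,
    forEntries, Prog.Tame]

theorem tame_igProg : igProg.Tame := by
  simp [igProg, matMul, forEntries, Prog.Tame]

/-- The quartic terms come from `krylov` and `hornerStep`, which cost `O(n ^ 3)` in each of `n`
rounds; the constant `40` is not sharp. -/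
theorem opsBound_crossedProg (n : ℕ) : crossedProg.opsBound n ≤ 40 * n ^ 4 := by
  have h1 : n ≤ n ^ 4 := Nat.le_self_pow (by simp) n
  have h2 : n ^ 2 ≤ n ^ 4 := by
    rw [show n ^ 4 = (n ^ 2) ^ 2 by ring]; exact Nat.le_self_pow (by simp) _
  have h3 : n ^ 3 ≤ n ^ 4 := by
    rcases n.eq_zero_or_pos with rfl | hn
    · simp
    · exact Nat.pow_le_pow_right hn (by simp)
  simp only [crossedProg, charpolyProg, copyRow, unitVector, krylov, divideSeries, idempotentProg,
    idempotentStep, groupInverseProg, hornerStep, accumulateStep, verifyProg, matMul, checkEq,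
    forEntries, Prog.opsBound]
  ring_nf
  omega

/-- The count is in fact quadratic: `n` tests for idempotents and `n ^ 2` for each of the two
equality checks. -/
theorem testsBound_crossedProg (n : ℕ) : crossedProg.testsBound n ≤ 40 * n ^ 3 := by
  have h1 : n ≤ n ^ 3 := Nat.le_self_pow (by simp) n
  have h2 : n ^ 2 ≤ n ^ 3 := by
    rcases n.eq_zero_or_pos with rfl | hn
    · simp
    · exact Nat.pow_le_pow_right hn (by simp)
  simp only [crossedProg, charpolyProg, copyRow, unitVector, krylov, divideSeries, idempotentProg,
    idempotentStep, groupInverseProg, hornerStep, accumulateStep, verifyProg, matMul, checkEq,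
    forEntries, Prog.testsBound]
  ring_nf
  omega

theorem testsBound_igProg (n : ℕ) : igProg.testsBound n = 0 := by
  simp [igProg, matMul, forEntries, Prog.testsBound]

theorem opsBound_igProg (n : ℕ) : igProg.opsBound n ≤ 40 * n ^ 4 := by
  have h3 : n ^ 3 ≤ n ^ 4 := by
    rcases n.eq_zero_or_pos with rfl | hn
    · simp
    · exact Nat.pow_le_pow_right hn (by simp)
  simp only [igProg, matMul, forEntries, Prog.opsBound]
  ring_nf
  omega

end RingProg

/-- There are two programs, the same for all rings and all sizes.  The first one decides whether
`φ` and `φ'` are crossed (answer `1` or `0` in index register `2`), with `O(n ^ 4)` arithmetic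
operations and `O(n ^ 3)` tests.  Started where the first one has stopped with answer `1`, the
second one puts the matrices of `Ig(φ, φ')` and `Ig(φ', φ)` into the arrays `4` and `5`, with
`O(n ^ 4)` arithmetic operations and no further test. -/
theorem mainTheorem4 :
    ∃ (decideProg invertProg : RingProg.Prog) (C : ℕ),
      ∀ (R : Type*) [CommRing R] (δ : R → R → Option R) (_ : RingProg.IsDivTest δ)
        (E F : Type*) [AddCommGroup E] [Module R E] [AddCommGroup F] [Module R F]
        (n p q : ℕ) (_ : p ≤ n) (_ : q ≤ n) (DE : ProjData R E p) (DF : ProjData R F q)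
        (φ : E →ₗ[R] F) (φ' : F →ₗ[R] E) (s₁ s₂ : RingProg.State R)
        (_ : s₁ = RingProg.run δ decideProg
          (RingProg.input DE.mat DF.mat (repMatrix DE DF φ) (repMatrix DF DE φ')))
        (_ : s₂ = RingProg.run δ invertProg s₁),
        (Crossed φ φ' → s₁.idx 2 = 1) ∧
        (¬ Crossed φ φ' → s₁.idx 2 = 0) ∧
        s₁.ops ≤ C * n ^ 4 ∧
        s₁.tests ≤ C * n ^ 3 ∧
        ∀ h : Crossed φ φ',
          s₂.Holds 4 (repMatrix DF DE (Ig φ φ' h)) ∧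
          s₂.Holds 5 (repMatrix DE DF (Ig φ' φ h.symm)) ∧
          s₂.ops ≤ s₁.ops + C * n ^ 4 ∧
          s₂.tests = s₁.tests := by
  classical
  refine ⟨RingProg.crossedProg, RingProg.igProg, 40, ?_⟩
  intro R _ δ hδ E F _ _ _ _ n p q hp hq DE DF φ φ' s₁ s₂ hs₁ hs₂
  set M := repMatrix DE DF φ with hM
  set M' := repMatrix DF DE φ' with hM'
  obtain ⟨a1, a2, a3, a4, Z, a5, hc, hZ, hflag⟩ := RingProg.run_crossedProg hδ hs₁
  have hidx : ∀ k ≠ 2, (RingProg.input DE.mat DF.mat M M').idx k ≤ n := by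
    rintro (_ | _ | k) _
    · exact hp
    · exact hq
    · exact Nat.zero_le n
  obtain ⟨b1, b2, b3⟩ := RingProg.tame_crossedProg.run_cost (δ := δ) _ hidx
  rw [← hs₁] at b1 b2 b3
  obtain ⟨-, c2, c3⟩ := RingProg.tame_igProg.run_cost (δ := δ) _ b1
  rw [← hs₂] at c2 c3
  refine ⟨fun h => ?_, fun h => ?_, ?_, ?_, fun h => ?_⟩
  · obtain ⟨S, hS, d1, d2, -, -⟩ := h.exists_groupInverse DE DF hM hM'
    obtain ⟨e1, e2, -, -⟩ := hS.formulas d1 d2 hc (hZ S hS)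
    rw [hflag, if_pos ⟨e1, e2⟩]
  -- Soundness needs only that `Z` commutes with `M * M'` and passes the check, not how it was
  -- found.
  · rw [hflag, if_neg fun h' => h (crossed_of_matrix hM hM' hc h'.1 h'.2)]
  · exact b2.trans ((Nat.zero_add _).le.trans (RingProg.opsBound_crossedProg n))
  · exact b3.trans ((Nat.zero_add _).le.trans (RingProg.testsBound_crossedProg n))
  · obtain ⟨S, hS, d1, d2, d3, d4⟩ := h.exists_groupInverse DE DF hM hM'
    obtain ⟨-, -, e3, e4⟩ := hS.formulas d1 d2 hc (hZ S hS)
    obtain ⟨g1, g2⟩ := RingProg.run_igProg (δ := δ) a1 a2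
    rw [← hs₂, a5] at g1 g2
    rw [a4, e3, d3] at g1
    rw [a3, e4, d4] at g2
    refine ⟨fun i j => ?_, fun i j => ?_, c2.trans ?_, ?_⟩
    · rw [← g1]; rfl
    · rw [← g2]; rfl
    · have := RingProg.opsBound_igProg n
      omega
    · rw [RingProg.testsBound_igProg, Nat.add_zero] at c3
      exact le_antisymm c3 (hs₂ ▸ RingProg.tests_le_run_tests _ _)
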